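/- All logarithms are to base $2$. Let $\mathcal X,\mathcal Y$ be finite alphabets, let $\mu_X$ be a probability distribution on $\mathcal X$, and let $\mu_{Y|X}$ be an arbitrary channel (stochastic matrix) from $\mathcal X$ to $\mathcal Y$, used as a stationary memoryless channel: $\mu_{Y|X}(\boldsymbol y|\boldsymbol x)=\prod_{i=1}^n\mu_{Y|X}(y_i|x_i)$, and likewise $\mu_X(\boldsymbol x)=\prod_i\mu_X(x_i)$, $\mu_{X|Y}(\boldsymbol x|\boldsymbol y)=\prod_i\mu_{X|Y}(x_i|y_i)$, where $\mu_{XY}(x,y)=\mu_X(x)\mu_{Y|X}(y|x)$. Put $\mathrm{Capacity}=\max_{\mu_X}I(X;Y)$. **Ensembles and the hash property.** For each block length $n$ let $\mathcal A=\mathcal A_n$ be a set of functions $A:\mathcal X^n\to\overline{\mathcal X}_{\mathcal A}$ into a finite set, with a probability distribution $p_A$ on $\mathcal A$, and let $\mathrm{Im}\mathcal A=\bigcup_{A\in\mathcal A}\{A\boldsymbol u:\boldsymbol u\in\mathcal X^n\}$. The ensemble $(\mathcal A,p_A)$ has a hash property if $\frac1n\log\frac{|\overline{\mathcal X}_{\mathcal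 A}|}{|\mathrm{Im}\mathcal A|}\to0$ and there are sequences $\alpha(n)\to1$, $\beta(n)\to0$ such that for all $n\ge1$ and all $\mathcal T,\mathcal T'\subset\mathcal X^n$ $$\sum_{\boldsymbol u\in\mathcal T,\ \boldsymbol u'\in\mathcal T'}p_A(\{A:A\boldsymbol u=A\boldsymbol u'\})\le|\mathcal T\cap\mathcal T'|+\frac{|\mathcal T||\mathcal T'|\,\alpha(n)}{|\mathrm{Im}\mathcal A|}+\min\{|\mathcal T|,|\mathcal T'|\}\,\beta(n).$$ The product ensemble $(\mathcal A\times\mathcal B,p_A\times p_B)$ consists of the functions $\boldsymbol u\mapsto(A\boldsymbol u,B\boldsymbol u)$ with $A$ and $B$ drawn independently; its hash property is the same condition with $\mathrm{Im}\mathcal A\times\mathrm{Im}\mathcal B$ as its image set. **The code.** Let $A:\mathcal X^n\to\mathcal X^{l_{\mathcal A}}$ for $A\in\mathcal A$ and $B:\mathcal X^n\to\mathcal X^{l_{\mathcal B}}$ for $B\in\mathcal B$, where the integers $l_{\mathcal A}=l_{\mathcal A}(n)$, $l_{\mathcal B}=l_{\mathcal B}(n)$ equal $n[H(X|Y)+\varepsilon_A]/\log|\mathcal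 X|$ and $n[I(X;Y)-\varepsilon_B]/\log|\mathcal X|$ up to $o(n)$ (in particular, for any rounding of these numbers). Given $A$, $B$ and $\boldsymbol c\in\mathcal X^{l_{\mathcal A}}$, a message $\boldsymbol m$, uniform on $\mathrm{Im}\mathcal B$, is encoded as $$\varphi(\boldsymbol m)=\arg\max_{\boldsymbol x:\,A\boldsymbol x=\boldsymbol c,\ B\boldsymbol x=\boldsymbol m}\mu_X(\boldsymbol x),$$ and the output $\boldsymbol y$ is decoded as $$\varphi^{-1}(\boldsymbol y)=B\,g_A(\boldsymbol c|\boldsymbol y),\qquad g_A(\boldsymbol c|\boldsymbol y)=\arg\max_{\boldsymbol x:\,A\boldsymbol x=\boldsymbol c}\mu_{X|Y}(\boldsymbol x|\boldsymbol y).$$ Ties are broken by an arbitrary total order on $\mathcal X^n$ fixed for each $n$, and the value of $\arg\max$ over an empty set is arbitrary. The rate is $R(B)=\frac1n\log|\mathrm{Im}\mathcal B|$ and the error probability is $$\mathrm{Error}_{Y|X}(A,B,\boldsymbol c)=\sum_{\boldsymbol m\in\mathrm{Im}\mathcal B}\frac1{|\mathrm{Im}\mathcal B|}\sum_{\boldsymbol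 y:\,\varphi^{-1}(\boldsymbol y)\ne\boldsymbol m}\mu_{Y|X}(\boldsymbol y|\varphi(\boldsymbol m)).$$ **Theorem.** Let $0<\varepsilon_A<\varepsilon_B$ satisfy $$\varepsilon_B-\varepsilon_A\le\sqrt{6[\varepsilon_B-\varepsilon_A]}\,\log|\mathcal X|<\varepsilon_A,$$ and assume that $(\mathcal A,p_A)$ and $(\mathcal A\times\mathcal B,p_A\times p_B)$ have a hash property. Then for every $\delta>0$ and all sufficiently large $n$ there are $A\in\mathcal A$, $B\in\mathcal B$ and $\boldsymbol c\in\mathrm{Im}A$ such that $$R(B)\ge I(X;Y)-\varepsilon_B-\delta,\qquad \mathrm{Error}_{Y|X}(A,B,\boldsymbol c)<\delta.$$ If moreover $\mu_X$ attains the capacity, then also $|R(B)-\mathrm{Capacity}|\le\varepsilon_B+\delta$, so that the rate approaches the capacity as $\varepsilon_B\to0$ and $\delta\to0$. -/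

import Mathlib

open Filter Topology

noncomputable section

namespace HashCoding

/-! Base 2 information measures of a pair `(X, Y)` with input law `p` and channel `W`,
`W x y` being the probability of the output `y` given the input `x`. -/

/-- Entropy `H(p) = ∑ p(u) log (1 / p(u))`; a term with `p u = 0` is `0`. -/
def entropy {X : Type*} [Fintype X] (p : X → ℝ) : ℝ :=
  ∑ x, p x * Real.logb 2 (1 / p x)

/-- The output marginal `μ_Y`. -/
def outputLaw {X Y : Type*} [Fintype X] (p : X → ℝ) (W : X → Y → ℝ) (y : Y) : ℝ :=
  ∑ x, p x * W x y

/-- The conditional probability `μ_{X|Y}(x|y)` (equal to `0` if `μ_Y(y) = 0`). -/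
def posterior {X Y : Type*} [Fintype X] (p : X → ℝ) (W : X → Y → ℝ) (x : X) (y : Y) : ℝ :=
  p x * W x y / outputLaw p W y

/-- Conditional entropy `H(X|Y) = ∑ μ_{X|Y}(x|y) μ_Y(y) log (1 / μ_{X|Y}(x|y))`. -/
def condEntropy {X Y : Type*} [Fintype X] [Fintype Y] (p : X → ℝ) (W : X → Y → ℝ) : ℝ :=
  ∑ x, ∑ y, posterior p W x y * outputLaw p W y * Real.logb 2 (1 / posterior p W x y)

/-- Mutual information `I(X;Y) = H(X) - H(X|Y)`. -/
def mutualInfo {X Y : Type*} [Fintype X] [Fintype Y] (p : X → ℝ) (W : X → Y → ℝ) : ℝ :=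
  entropy p - condEntropy p W

/-- The capacity of `W`: the supremum of `I(X;Y)` over all input laws. -/
def capacity {X Y : Type*} [Fintype X] [Fintype Y] (W : X → Y → ℝ) : ℝ :=
  sSup ((fun p : X → ℝ => mutualInfo p W) '' stdSimplex ℝ X)

/-! Memoryless extensions to sequences of length `n`. -/

/-- `μ_X(x) = ∏ i, μ_X(x_i)`. -/
def seqLaw {X : Type*} (p : X → ℝ) {n : ℕ} (x : Fin n → X) : ℝ := ∏ i, p (x i)

/-- `μ_{Y|X}(y|x) = ∏ i, μ_{Y|X}(y_i|x_i)`. -/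
def seqChannel {X Y : Type*} (W : X → Y → ℝ) {n : ℕ} (x : Fin n → X) (y : Fin n → Y) : ℝ :=
  ∏ i, W (x i) (y i)

/-- `μ_{X|Y}(x|y) = ∏ i, μ_{X|Y}(x_i|y_i)`. -/
def seqPosterior {X Y : Type*} [Fintype X] (p : X → ℝ) (W : X → Y → ℝ) {n : ℕ}
    (x : Fin n → X) (y : Fin n → Y) : ℝ :=
  ∏ i, posterior p W (x i) (y i)

/-! Ensembles of functions and the hash property. -/

/-- An ensemble: a set of functions `D → R` with a probability distribution on it. -/
structure Ensemble (D R : Type*) where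
  carrier : Finset (D → R)
  prob : (D → R) → ℝ
  prob_nonneg : ∀ A ∈ carrier, 0 ≤ prob A
  prob_sum : ∑ A ∈ carrier, prob A = 1

namespace Ensemble

/-- `Im 𝒜 = ⋃_{A ∈ 𝒜} {A u : u}`. -/
def im {D R : Type*} [Fintype D] [DecidableEq R] (E : Ensemble D R) : Finset R :=
  E.carrier.biUnion fun A => Finset.univ.image A

/-- `p_A({A : A u = A u'})`. -/
def collisionProb {D R : Type*} [DecidableEq R] (E : Ensemble D R) (u u' : D) : ℝ :=
  ∑ A ∈ E.carrier with A u = A u', E.prob A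

/-- `(A, B) ↦ A ⊕ B`, where `(A ⊕ B) u = (A u, B u)`. -/
def pairing (D R S : Type*) : (D → R) × (D → S) ↪ (D → R × S) where
  toFun F := fun u => (F.1 u, F.2 u)
  inj' := by
    rintro ⟨A, B⟩ ⟨A', B'⟩ h
    have h' : ∀ u, A u = A' u ∧ B u = B' u := fun u => by
      simpa using congrFun h u
    exact Prod.ext (funext fun u => (h' u).1) (funext fun u => (h' u).2)

/-- The ensemble `(𝒜 × ℬ, p_A × p_B)` of the functions `A ⊕ B`. -/
def prod {D R S : Type*} (EA : Ensemble D R) (EB : Ensemble D S) : Ensemble D (R × S) where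
  carrier := (EA.carrier ×ˢ EB.carrier).map (pairing D R S)
  prob F := EA.prob (fun u => (F u).1) * EB.prob (fun u => (F u).2)
  prob_nonneg := by
    intro F hF
    obtain ⟨⟨A, B⟩, h, rfl⟩ := Finset.mem_map.1 hF
    obtain ⟨hA, hB⟩ := Finset.mem_product.1 h
    exact mul_nonneg (EA.prob_nonneg A hA) (EB.prob_nonneg B hB)
  prob_sum := by
    rw [Finset.sum_map, Finset.sum_product]
    change ∑ A ∈ EA.carrier, ∑ B ∈ EB.carrier, EA.prob A * EB.prob B = 1
    rw [← Finset.sum_mul_sum, EA.prob_sum, EB.prob_sum, one_mul]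

end Ensemble

/-- The four hash conditions for a sequence of ensembles of functions on `X^n` with range `R n`
and image set `I n`. -/
def HashConditions {X : Type*} [DecidableEq X] {R : ℕ → Type*} [∀ n, Fintype (R n)]
    [∀ n, DecidableEq (R n)] (E : ∀ n, Ensemble (Fin n → X) (R n)) (I : ∀ n, Finset (R n))
    (α β : ℕ → ℝ) : Prop :=
  Tendsto (fun n : ℕ => Real.logb 2 ((Fintype.card (R n) : ℝ) / ((I n).card : ℝ)) / (n : ℝ))
      atTop (𝓝 0) ∧
  Tendsto α atTop (𝓝 1) ∧
  Tendsto β atTop (𝓝 0) ∧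
  ∀ n : ℕ, 1 ≤ n → ∀ T T' : Finset (Fin n → X),
    ∑ u ∈ T, ∑ u' ∈ T', (E n).collisionProb u u' ≤
      ((T ∩ T').card : ℝ) + (T.card : ℝ) * (T'.card : ℝ) * α n / ((I n).card : ℝ)
        + min (T.card : ℝ) (T'.card : ℝ) * β n

/-- `(𝒜, p_A)` has a hash property. -/
def HasHashProperty {X : Type*} [Fintype X] [DecidableEq X] {l : ℕ → ℕ}
    (EA : ∀ n, Ensemble (Fin n → X) (Fin (l n) → X)) : Prop :=
  ∃ α β : ℕ → ℝ, HashConditions EA (fun n => (EA n).im) α β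

/-- `(𝒜 × ℬ, p_A × p_B)` has a hash property; its image set is `Im 𝒜 × Im ℬ`. -/
def HasJointHashProperty {X : Type*} [Fintype X] [DecidableEq X] {l l' : ℕ → ℕ}
    (EA : ∀ n, Ensemble (Fin n → X) (Fin (l n) → X))
    (EB : ∀ n, Ensemble (Fin n → X) (Fin (l' n) → X)) : Prop :=
  ∃ α β : ℕ → ℝ,
    HashConditions (fun n => (EA n).prod (EB n)) (fun n => (EA n).im ×ˢ (EB n).im) α β

/-! The coset code. -/

/-- `arg max_{x ∈ S} f x`: among several maximizers the one of largest `rank` is taken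
(an arbitrary point if `S` is empty). -/
def argmaxOn {D : Type*} [Nonempty D] (rank : D ↪ ℕ) (f : D → ℝ) (S : Set D) : D :=
  Classical.epsilon fun x =>
    x ∈ S ∧ ∀ x' ∈ S, f x' < f x ∨ (f x' = f x ∧ rank x' ≤ rank x)

/-- `𝒞_A(c) = {u : A u = c}`. -/
def coset {D R : Type*} (A : D → R) (c : R) : Set D := {u | A u = c}

/-- The encoder `φ(m) = g_{AB}(c, m) = arg max_{x ∈ 𝒞_A(c) ∩ 𝒞_B(m)} μ_X(x)`. -/
def encoder {X : Type*} [Nonempty X] (p : X → ℝ) {n k l : ℕ} (rank : (Fin n → X) ↪ ℕ)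
    (A : (Fin n → X) → (Fin k → X)) (B : (Fin n → X) → (Fin l → X)) (c : Fin k → X)
    (m : Fin l → X) : Fin n → X :=
  argmaxOn rank (seqLaw p) (coset A c ∩ coset B m)

/-- The decoder `y ↦ B g_A(c|y)`, where `g_A(c|y) = arg max_{x ∈ 𝒞_A(c)} μ_{X|Y}(x|y)`. -/
def decoder {X Y : Type*} [Fintype X] [Nonempty X] (p : X → ℝ) (W : X → Y → ℝ) {n k l : ℕ}
    (rank : (Fin n → X) ↪ ℕ) (A : (Fin n → X) → (Fin k → X)) (B : (Fin n → X) → (Fin l → X))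
    (c : Fin k → X) (y : Fin n → Y) : Fin l → X :=
  B (argmaxOn rank (fun x => seqPosterior p W x y) (coset A c))

/-- The uniform message distribution `p_M` on `Im ℬ`. -/
def messageLaw {M : Type*} [DecidableEq M] (I : Finset M) (m : M) : ℝ :=
  if m ∈ I then 1 / (I.card : ℝ) else 0

/-- The rate `log |Im ℬ| / n`. -/
def rate {M : Type*} (n : ℕ) (I : Finset M) : ℝ := Real.logb 2 (I.card : ℝ) / (n : ℝ)

/-- The decoding error probability `Error_{Y|X}(A, B, c)`. -/
def decodingError {X Y : Type*} [Fintype X] [DecidableEq X] [Nonempty X] [Fintype Y]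
    (p : X → ℝ) (W : X → Y → ℝ) {n k l : ℕ} (rank : (Fin n → X) ↪ ℕ)
    (EB : Ensemble (Fin n → X) (Fin l → X))
    (A : (Fin n → X) → (Fin k → X)) (B : (Fin n → X) → (Fin l → X)) (c : Fin k → X) : ℝ :=
  ∑ m : Fin l → X, ∑ y : Fin n → Y,
    messageLaw EB.im m * seqChannel W (encoder p rank A B c m) y *
      (if decoder p W rank A B c y ≠ m then 1 else 0)

end HashCoding

end

namespace HashCoding

/-! Write γ = ε_B − ε_A and τ = √(6γ) log|X|. The error is averaged over A, B, c and m, and a good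
triple (A, B, c) is then extracted. Up to subexponential factors, |Im 𝒜| is 2^{n(H(X|Y)+ε_A)} and
|Im 𝒜 × Im ℬ| is 2^{n(H(X)−γ)}.

Let T consist of the K·|Im 𝒜 × Im ℬ| first sequences in the encoder's order, with K a large
constant. There are about 2^{nH(X)} sequences of probability at least 2^{-n(H(X)+s)}, so all of T is
that likely (`exists_upper_finset_likely`). By the second moment method a random coset misses T with
probability about 1/K (`Ensemble.sum_missed_le`). If it meets T, the encoder's choice lies in T,
since T is closed upwards.

The chosen input is not distributed as μ_X, so it need not be jointly typical with its output. This
is repaired by counting. Let D(a) = D(W(·|a) ‖ μ_Y), a nonnegative function of the input letter with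
mean I(X;Y) and second moment at most 4 (log|X|)². A one-sided tail bound gives the event that the
sum of D along x is at most n(I(X;Y) − τ) probability at most e^{-3γn/4}. As 3/(4 ln 2) > 1, the set
U of likely sequences with this defect is exponentially smaller than |Im 𝒜 × Im ℬ|
(`card_uninformative_le`), so a random coset rarely meets U.

For x in T outside U, likelihood and information together bound the mean of log 1/μ_{X|Y}(x|Y) by
n(H(X|Y) + τ + s), and the Chernoff bound gives concentration (`exists_posterior_tail_rate`). At
most about 2^{n(H(X|Y)+τ)} competitors have so large a posterior, and since τ < ε_A the hash
property of 𝒜 makes a collision with one of them unlikely (`jointSum_confusion_le`). -/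

/-! ### The tie-breaking order and its maximizers -/

theorem exists_upper_finset_card {D κ : Type*} [Fintype D] [LinearOrder κ] {key : D → κ}
    (hkey : Function.Injective key) (m : ℕ) (hm : m ≤ Fintype.card D) :
    ∃ U : Finset D, U.card = m ∧ ∀ x ∈ U, ∀ x', key x ≤ key x' → x' ∈ U := by
  classical
  induction m with
  | zero => exact ⟨∅, by simp⟩
  | succ m ih =>
    obtain ⟨U, hU, hup⟩ := ih (by omega)
    have hne : (Finset.univ \ U).Nonempty := by
      rw [← Finset.card_pos, Finset.card_sdiff_of_subset (Finset.subset_univ U),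
        Finset.card_univ]
      omega
    obtain ⟨x, hx, hmax⟩ := Finset.exists_max_image _ key hne
    have hxU : x ∉ U := (Finset.mem_sdiff.1 hx).2
    refine ⟨insert x U, by rw [Finset.card_insert_of_notMem hxU, hU], ?_⟩
    intro z hz x' hzx'
    by_cases hx' : x' ∈ U
    · exact Finset.mem_insert_of_mem hx'
    · rcases Finset.mem_insert.1 hz with rfl | hz
      · have := hmax x' (by simp [hx'])
        exact Finset.mem_insert.2 (Or.inl (hkey (le_antisymm this hzx')))
      · exact absurd (hup z hz x' hzx') hx'

/-- The order in which `argmaxOn rank f` compares points. -/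
def rankKey {D : Type*} (rank : D ↪ ℕ) (f : D → ℝ) (x : D) : ℝ ×ₗ ℕ := toLex (f x, rank x)

theorem rankKey_injective {D : Type*} (rank : D ↪ ℕ) (f : D → ℝ) :
    Function.Injective (rankKey rank f) := by
  intro x y h
  have h' : (f x, rank x) = (f y, rank y) := toLex.injective h
  exact rank.injective (Prod.ext_iff.1 h').2

theorem rankKey_le_iff {D : Type*} (rank : D ↪ ℕ) (f : D → ℝ) (x y : D) :
    rankKey rank f x ≤ rankKey rank f y ↔ f x < f y ∨ (f x = f y ∧ rank x ≤ rank y) := by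
  simp [rankKey, Prod.Lex.toLex_le_toLex]

theorem argmaxOn_spec {D : Type*} [Nonempty D] [Finite D] (rank : D ↪ ℕ) (f : D → ℝ)
    {S : Set D} (hS : S.Nonempty) :
    argmaxOn rank f S ∈ S ∧
      ∀ x ∈ S, rankKey rank f x ≤ rankKey rank f (argmaxOn rank f S) := by
  obtain ⟨x, hx, hmax⟩ := Set.exists_max_image S (rankKey rank f) (Set.toFinite S) hS
  have := Classical.epsilon_spec
    (p := fun x => x ∈ S ∧ ∀ x' ∈ S, f x' < f x ∨ (f x' = f x ∧ rank x' ≤ rank x))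
    ⟨x, hx, fun x' hx' => (rankKey_le_iff rank f x' x).1 (hmax x' hx')⟩
  exact ⟨this.1, fun x' hx' => (rankKey_le_iff rank f x' _).2 (this.2 x' hx')⟩

/-! ### Averaging over the ensembles at a fixed block length -/

section OneShot

variable {D R S Z : Type*}

theorem Ensemble.apply_mem_im [Fintype D] [DecidableEq R] (E : Ensemble D R) {A : D → R}
    (hA : A ∈ E.carrier) (u : D) : A u ∈ E.im :=
  Finset.mem_biUnion.2 ⟨A, hA, Finset.mem_image_of_mem A (Finset.mem_univ u)⟩

theorem Ensemble.carrier_nonempty (E : Ensemble D R) : E.carrier.Nonempty := by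
  by_contra h
  have := E.prob_sum
  rw [Finset.not_nonempty_iff_eq_empty.1 h] at this
  simp at this

theorem Ensemble.im_nonempty [Fintype D] [Nonempty D] [DecidableEq R] (E : Ensemble D R) :
    E.im.Nonempty := by
  obtain ⟨A, hA⟩ := E.carrier_nonempty
  exact ⟨_, E.apply_mem_im hA (Classical.arbitrary D)⟩

theorem Ensemble.sum_prob_ite [DecidableEq R] (E : Ensemble D R) (u u' : D) :
    ∑ A ∈ E.carrier, E.prob A * (if A u = A u' then 1 else 0) = E.collisionProb u u' := by
  rw [Ensemble.collisionProb, Finset.sum_filter]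
  exact Finset.sum_congr rfl fun A _ => by split_ifs <;> simp

/-- The proportion of values whose fibre misses `T` is small, by the second moment method. -/
theorem Ensemble.sum_missed_le [DecidableEq D] [DecidableEq R] (E : Ensemble D R) (I : Finset R)
    (hI : ∀ F ∈ E.carrier, ∀ u, F u ∈ I) (hI0 : I.Nonempty) (T : Finset D) (hT : T.Nonempty)
    {α β : ℝ}
    (h : ∑ u ∈ T, ∑ u' ∈ T, E.collisionProb u u' ≤
      (T.card : ℝ) + T.card * T.card * α / I.card + T.card * β) :
    ∑ F ∈ E.carrier, E.prob F * ∑ r ∈ I, (if ∃ u ∈ T, F u = r then (0 : ℝ) else 1) ≤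
      I.card * (α - 1 + I.card * (1 + β) / T.card) := by
  have hi : (0 : ℝ) < I.card := by exact_mod_cast hI0.card_pos
  have ht : (0 : ℝ) < T.card := by exact_mod_cast hT.card_pos
  have key : ∀ F ∈ E.carrier, ∑ r ∈ I, (if ∃ u ∈ T, F u = r then (0 : ℝ) else 1) ≤
      (I.card / T.card) ^ 2 * (∑ u ∈ T, ∑ u' ∈ T, if F u = F u' then (1 : ℝ) else 0) - I.card := by
    intro F hF
    set N : R → ℝ := fun r => ∑ u ∈ T, if F u = r then (1 : ℝ) else 0 with hN
    have h1 : ∑ r ∈ I, N r = T.card := by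
      rw [hN, Finset.sum_comm]
      rw [Finset.sum_congr rfl (fun u _ => Finset.sum_ite_eq I (F u) (fun _ => (1 : ℝ)))]
      rw [Finset.sum_congr rfl (fun u _ => if_pos (hI F hF u))]
      simp
    have h2 : ∑ r ∈ I, N r ^ 2 = ∑ u ∈ T, ∑ u' ∈ T, if F u = F u' then (1 : ℝ) else 0 := by
      simp only [hN, sq, Finset.sum_mul_sum]
      rw [Finset.sum_comm]
      refine Finset.sum_congr rfl fun u _ => ?_
      rw [Finset.sum_comm]
      refine Finset.sum_congr rfl fun u' _ => ?_
      rw [Finset.sum_eq_single (F u)]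
      · simp [eq_comm]
      · intro r _ hr
        simp [hr.symm]
      · intro hu
        exact absurd (hI F hF u) hu
    -- Chebyshev's argument: the mean of N over I is exactly |T|/|I| for every F, and an empty fibre
    -- contributes 1 to the squared deviation of N divided by its mean.
    calc ∑ r ∈ I, (if ∃ u ∈ T, F u = r then (0 : ℝ) else 1)
        ≤ ∑ r ∈ I, ((I.card / T.card) * N r - 1) ^ 2 := by
          refine Finset.sum_le_sum fun r _ => ?_
          split_ifs with hr
          · positivity
          · have : N r = 0 := Finset.sum_eq_zero fun u hu => if_neg fun he => hr ⟨u, hu, he⟩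
            rw [this]; norm_num
      _ = (I.card / T.card) ^ 2 * ∑ r ∈ I, N r ^ 2 - 2 * (I.card / T.card) * ∑ r ∈ I, N r
            + I.card := by
          rw [Finset.mul_sum, Finset.mul_sum, ← Finset.sum_sub_distrib]
          rw [Finset.card_eq_sum_ones, Nat.cast_sum, ← Finset.sum_add_distrib]
          exact Finset.sum_congr rfl fun r _ => by push_cast; ring
      _ = _ := by
          rw [h1, h2]; field_simp; ring
  calc _ ≤ ∑ F ∈ E.carrier, E.prob F * ((I.card / T.card) ^ 2 *
          (∑ u ∈ T, ∑ u' ∈ T, if F u = F u' then (1 : ℝ) else 0) - I.card) :=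
        Finset.sum_le_sum fun F hF => mul_le_mul_of_nonneg_left (key F hF) (E.prob_nonneg F hF)
    _ = (I.card / T.card) ^ 2 * (∑ u ∈ T, ∑ u' ∈ T, E.collisionProb u u') - I.card := by
        simp only [mul_sub, Finset.sum_sub_distrib, ← Finset.sum_mul, E.prob_sum, one_mul]
        congr 1
        simp only [← E.sum_prob_ite, Finset.mul_sum]
        rw [Finset.sum_comm]
        refine Finset.sum_congr rfl fun u _ => ?_
        rw [Finset.sum_comm]
        exact Finset.sum_congr rfl fun u' _ => Finset.sum_congr rfl fun F _ => by ring
    _ ≤ (I.card / T.card) ^ 2 *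
          ((T.card : ℝ) + T.card * T.card * α / I.card + T.card * β) - I.card := by
        gcongr
    _ = _ := by field_simp; ring

/-- The joint average of a function of `(A, B, c, m)`, up to normalization of `c` and `m`. -/
def jointSum (EA : Ensemble D R) (EB : Ensemble D S) (IA : Finset R) (IB : Finset S)
    (Φ : (D → R) → (D → S) → R → S → ℝ) : ℝ :=
  ∑ A ∈ EA.carrier, ∑ B ∈ EB.carrier, EA.prob A * EB.prob B * ∑ c ∈ IA, ∑ m ∈ IB, Φ A B c m

theorem jointSum_add (EA : Ensemble D R) (EB : Ensemble D S) (IA : Finset R) (IB : Finset S)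
    (Φ Ψ : (D → R) → (D → S) → R → S → ℝ) :
    jointSum EA EB IA IB (fun A B c m => Φ A B c m + Ψ A B c m) =
      jointSum EA EB IA IB Φ + jointSum EA EB IA IB Ψ := by
  simp only [jointSum, Finset.sum_add_distrib, mul_add]

theorem sum_prob_mul_prob (EA : Ensemble D R) (EB : Ensemble D S) :
    ∑ A ∈ EA.carrier, ∑ B ∈ EB.carrier, EA.prob A * EB.prob B = 1 := by
  rw [← Finset.sum_mul_sum, EA.prob_sum, EB.prob_sum, one_mul]

theorem jointSum_const (EA : Ensemble D R) (EB : Ensemble D S) (IA : Finset R) (IB : Finset S)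
    (η : ℝ) : jointSum EA EB IA IB (fun _ _ _ _ => η) = IA.card * IB.card * η := by
  simp only [jointSum, ← Finset.sum_mul, sum_prob_mul_prob, Finset.sum_const, nsmul_eq_mul]
  ring

/-- If the joint average is small then some `(A, B, c)` has a small average over `m`. -/
theorem exists_of_jointSum_lt (EA : Ensemble D R) (EB : Ensemble D S) (IA : Finset R)
    (IB : Finset S) (Φ : (D → R) → (D → S) → R → S → ℝ) {ε : ℝ}
    (h : jointSum EA EB IA IB Φ < IA.card * IB.card * ε) :
    ∃ A ∈ EA.carrier, ∃ B ∈ EB.carrier, ∃ c ∈ IA, ∑ m ∈ IB, Φ A B c m < IB.card * ε := by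
  by_contra! hcon
  refine absurd h (not_lt.2 ?_)
  rw [mul_assoc]
  calc (IA.card : ℝ) * (IB.card * ε)
      = ∑ A ∈ EA.carrier, ∑ B ∈ EB.carrier,
          EA.prob A * EB.prob B * ∑ _c ∈ IA, (IB.card * ε : ℝ) := by
        simp only [← Finset.sum_mul, sum_prob_mul_prob, Finset.sum_const, nsmul_eq_mul, one_mul]
        ring
    _ ≤ _ := Finset.sum_le_sum fun A hA => Finset.sum_le_sum fun B hB =>
        mul_le_mul_of_nonneg_left (Finset.sum_le_sum fun c hc => hcon A hA B hB c hc)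
          (mul_nonneg (EA.prob_nonneg A hA) (EB.prob_nonneg B hB))

theorem jointSum_missed_le [Fintype D] [DecidableEq D] [DecidableEq R] [DecidableEq S] [Nonempty D]
    (EA : Ensemble D R) (EB : Ensemble D S) (T : Finset D) (hT : T.Nonempty) {α β : ℝ}
    (h : ∑ u ∈ T, ∑ u' ∈ T, (EA.prod EB).collisionProb u u' ≤
      (T.card : ℝ) + T.card * T.card * α / (EA.im ×ˢ EB.im).card + T.card * β) :
    jointSum EA EB EA.im EB.im
      (fun A B c m => if ∃ u ∈ T, A u = c ∧ B u = m then (0 : ℝ) else 1) ≤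
      EA.im.card * EB.im.card * (α - 1 + EA.im.card * EB.im.card * (1 + β) / T.card) := by
  have := (EA.prod EB).sum_missed_le (EA.im ×ˢ EB.im) (fun F hF u => by
    obtain ⟨⟨A, B⟩, hAB, rfl⟩ := Finset.mem_map.1 hF
    obtain ⟨hA, hB⟩ := Finset.mem_product.1 hAB
    exact Finset.mk_mem_product (EA.apply_mem_im hA u) (EB.apply_mem_im hB u))
    (EA.im_nonempty.product EB.im_nonempty) T hT h
  rw [Finset.card_product, Nat.cast_mul] at this
  refine le_trans (le_of_eq ?_) this
  rw [jointSum, Ensemble.prod, Finset.sum_map, Finset.sum_product]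
  refine Finset.sum_congr rfl fun A _ => Finset.sum_congr rfl fun B _ => ?_
  rw [Finset.sum_product]
  change _ = EA.prob A * EB.prob B *
    ∑ c ∈ EA.im, ∑ m ∈ EB.im, (if ∃ u ∈ T, (A u, B u) = (c, m) then (0 : ℝ) else 1)
  simp only [Prod.mk.injEq]

/-- Averaging over `c` and `m` a sum over the points of the coset of `(c, m)`. -/
theorem jointSum_coset [Fintype D] [DecidableEq R] [DecidableEq S]
    (EA : Ensemble D R) (EB : Ensemble D S) (U : Finset D) (w : (D → R) → D → ℝ) :
    jointSum EA EB EA.im EB.im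
      (fun A B c m => ∑ x ∈ U, if A x = c ∧ B x = m then w A x else 0) =
      ∑ x ∈ U, ∑ A ∈ EA.carrier, EA.prob A * w A x := by
  have key : ∀ A ∈ EA.carrier, ∀ B ∈ EB.carrier,
      ∑ c ∈ EA.im, ∑ m ∈ EB.im, ∑ x ∈ U, (if A x = c ∧ B x = m then w A x else 0) =
        ∑ x ∈ U, w A x := by
    intro A hA B hB
    -- Every x lies in exactly one of the cosets indexed by (c, m).
    rw [← Finset.sum_product', Finset.sum_comm]
    refine Finset.sum_congr rfl fun x _ => ?_
    rw [Finset.sum_eq_single (A x, B x)]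
    · simp
    · rintro ⟨c, m⟩ _ hne
      refine if_neg fun h => hne ?_
      rw [h.1, h.2]
    · intro hx
      exact absurd (Finset.mk_mem_product (EA.apply_mem_im hA x) (EB.apply_mem_im hB x)) hx
  rw [jointSum, Finset.sum_comm (s := U)]
  refine Finset.sum_congr rfl fun A hA => ?_
  rw [Finset.sum_congr rfl fun B hB => by rw [key A hA B hB], ← Finset.sum_mul, ← Finset.mul_sum,
    EB.prob_sum, mul_one, Finset.mul_sum]

/-- The error probability for one message, bounded by the indicator that its coset misses the
set `T` of the most likely inputs and the contributions of the points of the coset in `T`. -/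
theorem message_error_le [Fintype D] [DecidableEq D] [Nonempty D] [DecidableEq R]
    [DecidableEq S] [Fintype Z] (rank : D ↪ ℕ) (f : D → ℝ) (V q : D → Z → ℝ)
    (hV : ∀ x, V x ∈ stdSimplex ℝ Z) (T U : Finset D)
    (hT : ∀ x ∈ T, ∀ x', rankKey rank f x ≤ rankKey rank f x' → x' ∈ T) {θ η : ℝ} (hη0 : 0 ≤ η)
    (hη : ∀ x ∈ T \ U, ∑ y, V x y * (if q x y < θ then 1 else 0) ≤ η)
    (A : D → R) (B : D → S) (c : R) (m : S) :
    ∑ y, V (argmaxOn rank f (coset A c ∩ coset B m)) y *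
        (if B (argmaxOn rank (fun x => q x y) (coset A c)) ≠ m then 1 else 0) ≤
      (if ∃ u ∈ T, A u = c ∧ B u = m then (0 : ℝ) else 1) +
        (∑ x ∈ U, if A x = c ∧ B x = m then (1 : ℝ) else 0) + η +
        ∑ x ∈ T \ U, if A x = c ∧ B x = m then
          ∑ y, V x y * ∑ x' ∈ Finset.univ.erase x with θ ≤ q x' y,
            (if A x = A x' then (1 : ℝ) else 0) else 0 := by
  set x₀ := argmaxOn rank f (coset A c ∩ coset B m) with hx₀
  have hU0 : 0 ≤ ∑ x ∈ U, if A x = c ∧ B x = m then (1 : ℝ) else 0 :=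
    Finset.sum_nonneg fun x _ => by split_ifs <;> norm_num
  have hin0 : ∀ x, 0 ≤ ∑ y, V x y * ∑ x' ∈ Finset.univ.erase x with θ ≤ q x' y,
      (if A x = A x' then (1 : ℝ) else 0) := fun x => Finset.sum_nonneg fun y _ =>
    mul_nonneg ((hV x).1 y) (Finset.sum_nonneg fun x' _ => by split_ifs <;> norm_num)
  have hT0 : ∀ x ∈ T \ U, 0 ≤ (if A x = c ∧ B x = m then
          ∑ y, V x y * ∑ x' ∈ Finset.univ.erase x with θ ≤ q x' y,
            (if A x = A x' then (1 : ℝ) else 0) else 0) := fun x _ => by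
    split_ifs
    · exact hin0 x
    · exact le_rfl
  have hle1 : ∑ y, V x₀ y *
      (if B (argmaxOn rank (fun x => q x y) (coset A c)) ≠ m then (1 : ℝ) else 0) ≤ 1 := by
    refine le_trans (Finset.sum_le_sum fun y _ => ?_) (hV x₀).2.le
    have := (hV x₀).1 y
    split_ifs <;> simp [this]
  by_cases hhit : ∃ u ∈ T, A u = c ∧ B u = m
  swap
  · rw [if_neg hhit]
    have := Finset.sum_nonneg hT0
    linarith
  rw [if_pos hhit]
  obtain ⟨u, huT, huc, hum⟩ := hhit
  have hspec := argmaxOn_spec rank f (S := coset A c ∩ coset B m) ⟨u, huc, hum⟩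
  rw [← hx₀] at hspec
  have hx₀T : x₀ ∈ T := hT u huT x₀ (hspec.2 u ⟨huc, hum⟩)
  have hx₀c : A x₀ = c := hspec.1.1
  have hx₀m : B x₀ = m := hspec.1.2
  by_cases hx₀U : x₀ ∈ U
  · have h1 : (1 : ℝ) ≤ ∑ x ∈ U, if A x = c ∧ B x = m then (1 : ℝ) else 0 := by
      have := Finset.single_le_sum (f := fun x => if A x = c ∧ B x = m then (1 : ℝ) else 0)
        (fun x _ => by split_ifs <;> norm_num) hx₀U
      simpa [hx₀c, hx₀m] using this
    have := Finset.sum_nonneg hT0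
    linarith
  · have hmem : x₀ ∈ T \ U := Finset.mem_sdiff.2 ⟨hx₀T, hx₀U⟩
    have h4 := Finset.single_le_sum hT0 hmem
    rw [if_pos ⟨hx₀c, hx₀m⟩] at h4
    have h3 := hη x₀ hmem
    -- A wrong message forces the decoder's choice g to differ from x₀. Both lie in the coset of c
    -- and q g y ≥ q x₀ y, so either q x₀ y is below θ or g is a colliding competitor above θ.
    have hsplit : ∑ y, V x₀ y *
        (if B (argmaxOn rank (fun x => q x y) (coset A c)) ≠ m then (1 : ℝ) else 0) ≤
        ∑ y, V x₀ y * (if q x₀ y < θ then 1 else 0) +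
        ∑ y, V x₀ y * ∑ x' ∈ Finset.univ.erase x₀ with θ ≤ q x' y,
            (if A x₀ = A x' then (1 : ℝ) else 0) := by
      rw [← Finset.sum_add_distrib]
      refine Finset.sum_le_sum fun y _ => ?_
      rw [← mul_add]
      refine mul_le_mul_of_nonneg_left ?_ ((hV x₀).1 y)
      have hs0 : 0 ≤ ∑ x' ∈ Finset.univ.erase x₀ with θ ≤ q x' y,
          (if A x₀ = A x' then (1 : ℝ) else 0) :=
        Finset.sum_nonneg fun x' _ => by split_ifs <;> norm_num
      by_cases hq : q x₀ y < θ
      · rw [if_pos hq]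
        split_ifs <;> linarith
      rw [if_neg hq, zero_add]
      split_ifs with hB
      · set g := argmaxOn rank (fun x => q x y) (coset A c) with hg
        have hgs := argmaxOn_spec rank (fun x => q x y) (S := coset A c) ⟨x₀, hx₀c⟩
        rw [← hg] at hgs
        have hgA : A g = c := hgs.1
        have hgne : g ≠ x₀ := fun h => hB (h ▸ hx₀m)
        have hgq : q x₀ y ≤ q g y := by
          rcases (rankKey_le_iff _ _ _ _).1 (hgs.2 x₀ hx₀c) with h | h
          · exact h.le
          · exact h.1.le
        have hgm : g ∈ (Finset.univ.erase x₀).filter (fun x' => θ ≤ q x' y) := by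
          simp only [Finset.mem_filter, Finset.mem_erase, Finset.mem_univ, and_true]
          exact ⟨hgne, (not_lt.1 hq).trans hgq⟩
        have := Finset.single_le_sum (f := fun x' => if A x₀ = A x' then (1 : ℝ) else 0)
          (fun x _ => by split_ifs <;> norm_num) hgm
        simpa [hx₀c, hgA] using this
      · exact hs0
    linarith

/-- The average contribution of the confusable points. -/
theorem jointSum_confusion_le [Fintype D] [DecidableEq D] [DecidableEq R] [DecidableEq S]
    [Fintype Z] (EA : Ensemble D R) (EB : Ensemble D S) (V q : D → Z → ℝ)
    (hV : ∀ x, V x ∈ stdSimplex ℝ Z) (T : Finset D) {θ α β N : ℝ} (hα : 0 ≤ α)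
    (hN : ∀ y, ((Finset.univ.filter fun x => θ ≤ q x y).card : ℝ) ≤ N)
    (h : ∀ x, ∀ G : Finset D, ∑ x' ∈ G, EA.collisionProb x x' ≤
      (({x} ∩ G).card : ℝ) + G.card * α / EA.im.card + β) :
    jointSum EA EB EA.im EB.im
      (fun A B c m => ∑ x ∈ T, if A x = c ∧ B x = m then
          ∑ y, V x y * ∑ x' ∈ Finset.univ.erase x with θ ≤ q x' y,
            (if A x = A x' then (1 : ℝ) else 0) else 0) ≤
      T.card * (N * α / EA.im.card + β) := by
  rw [jointSum_coset EA EB T (fun A x => ∑ y, V x y *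
    ∑ x' ∈ Finset.univ.erase x with θ ≤ q x' y, (if A x = A x' then (1 : ℝ) else 0))]
  rw [← nsmul_eq_mul, ← Finset.sum_const]
  refine Finset.sum_le_sum fun x _ => ?_
  calc _ = ∑ y, V x y * ∑ x' ∈ Finset.univ.erase x with θ ≤ q x' y, EA.collisionProb x x' := by
        simp only [← Ensemble.sum_prob_ite, Finset.mul_sum]
        rw [Finset.sum_comm]
        refine Finset.sum_congr rfl fun y _ => ?_
        rw [Finset.sum_comm]
        exact Finset.sum_congr rfl fun x' _ => Finset.sum_congr rfl fun A _ => by ring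
    _ ≤ ∑ y, V x y * (N * α / EA.im.card + β) := by
        refine Finset.sum_le_sum fun y _ => mul_le_mul_of_nonneg_left ?_ ((hV x).1 y)
        refine (h x _).trans ?_
        -- Erasing x removes the diagonal term of the hash inequality, which would otherwise
        -- contribute 1.
        have h0 : ({x} ∩ (Finset.univ.erase x).filter fun x' => θ ≤ q x' y) = ∅ := by
          ext z; simp +contextual
        rw [h0, Finset.card_empty, Nat.cast_zero, zero_add]
        have : (((Finset.univ.erase x).filter fun x' => θ ≤ q x' y).card : ℝ) ≤ N :=
          le_trans (Nat.cast_le.2 (Finset.card_le_card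
            (Finset.filter_subset_filter _ (Finset.erase_subset _ _)))) (hN y)
        gcongr
    _ = _ := by rw [← Finset.sum_mul, (hV x).2, one_mul]

end OneShot

/-! ### Exponential tail bounds -/

theorem sum_prod_apply {Y : Type*} [Fintype Y] {n : ℕ} (h : Fin n → Y → ℝ) :
    ∑ y : Fin n → Y, ∏ i, h i (y i) = ∏ i, ∑ b, h i b := by
  classical
  rw [Finset.prod_univ_sum, Fintype.piFinset_univ]

/-- Chernoff's bound for independent, uniformly bounded, centred variables. -/
theorem exists_chernoff_rate (M s : ℝ) (hM : 0 < M) (hs : 0 < s) :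
    ∃ r : ℝ, 0 < r ∧ r < 1 ∧ ∀ {Y : Type*} [Fintype Y] (n : ℕ) (P g : Fin n → Y → ℝ),
      (∀ i, P i ∈ stdSimplex ℝ Y) → (∀ i b, |g i b| ≤ M) → (∀ i, ∑ b, P i b * g i b = 0) →
      ∑ y : Fin n → Y, (∏ i, P i (y i)) * (if n * s ≤ ∑ i, g i (y i) then 1 else 0) ≤ r ^ n := by
  -- The first bound gives |t g| ≤ 1, hence exp(t g) ≤ 1 + t g + (t g)². The second keeps the
  -- quadratic term below t s / 2, half of the gain t s per coordinate. Since t depends only on M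
  -- and s, the rate is uniform in n and in the laws of the coordinates.
  set t : ℝ := min (1 / M) (s / (2 * M ^ 2)) with ht
  have ht0 : 0 < t := by positivity
  have htM : t * M ≤ 1 := by
    calc t * M ≤ 1 / M * M := by gcongr; exact min_le_left _ _
      _ = 1 := by field_simp
  have htM2 : t * M ^ 2 ≤ s / 2 := by
    calc t * M ^ 2 ≤ s / (2 * M ^ 2) * M ^ 2 := by gcongr; exact min_le_right _ _
      _ = s / 2 := by field_simp
  refine ⟨Real.exp (-(t * s / 2)), Real.exp_pos _, Real.exp_lt_one_iff.2 (by
    have : 0 < t * s := by positivity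
    linarith), ?_⟩
  intro Y _ n P g hP hg h0
  have hone : ∀ i, ∑ b, P i b * Real.exp (t * g i b) ≤ Real.exp (t * s / 2) := by
    intro i
    calc ∑ b, P i b * Real.exp (t * g i b)
        ≤ ∑ b, P i b * (1 + t * g i b + (t * M) ^ 2) := by
          refine Finset.sum_le_sum fun b _ => mul_le_mul_of_nonneg_left ?_ ((hP i).1 b)
          have h1 : |t * g i b| ≤ t * M := by
            rw [abs_mul, abs_of_pos ht0]; gcongr; exact hg i b
          have h2 := abs_le.1 (Real.abs_exp_sub_one_sub_id_le (h1.trans htM))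
          have h3 : (t * g i b) ^ 2 ≤ (t * M) ^ 2 := by
            rw [← sq_abs (t * g i b)]; gcongr
          linarith [h2.2]
      _ = (∑ b, P i b) * (1 + (t * M) ^ 2) + t * ∑ b, P i b * g i b := by
          rw [Finset.sum_mul, Finset.mul_sum, ← Finset.sum_add_distrib]
          exact Finset.sum_congr rfl fun b _ => by ring
      _ = (t * M) ^ 2 + 1 := by rw [(hP i).2, h0 i]; ring
      _ ≤ Real.exp ((t * M) ^ 2) := Real.add_one_le_exp _
      _ ≤ _ := Real.exp_le_exp.2 (by nlinarith)
  calc ∑ y : Fin n → Y, (∏ i, P i (y i)) * (if n * s ≤ ∑ i, g i (y i) then 1 else 0)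
      ≤ ∑ y : Fin n → Y, Real.exp (-(n * (t * s))) * ∏ i, (P i (y i) * Real.exp (t * g i (y i))) := by
        refine Finset.sum_le_sum fun y _ => ?_
        rw [Finset.prod_mul_distrib, ← Real.exp_sum, mul_left_comm, ← Real.exp_add,
          ← Finset.mul_sum]
        refine mul_le_mul_of_nonneg_left ?_ (Finset.prod_nonneg fun i _ => (hP i).1 _)
        split_ifs with h
        · rw [← Real.exp_zero]
          refine Real.exp_le_exp.2 ?_
          nlinarith
        · positivity
    _ = Real.exp (-(n * (t * s))) * ∏ i, ∑ b, P i b * Real.exp (t * g i b) := by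
        rw [← Finset.mul_sum, sum_prod_apply fun i b => P i b * Real.exp (t * g i b)]
    _ ≤ Real.exp (-(n * (t * s))) * ∏ _i : Fin n, Real.exp (t * s / 2) := by
        gcongr with i _
        · intro i _
          exact Finset.sum_nonneg fun b _ => mul_nonneg ((hP i).1 b) (Real.exp_pos _).le
        · exact hone i
    _ = _ := by
        rw [Finset.prod_const, Finset.card_univ, Fintype.card_fin, ← Real.exp_nat_mul,
          ← Real.exp_nat_mul, ← Real.exp_add]
        congr 1; ring

/-- For nonnegative variables this makes the lower tail depend on the second moment alone, with no
upper bound on the variables. The resulting exponent is then free of the smallest value of μ_X. -/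
theorem exp_neg_le_quadratic {u : ℝ} (hu : 0 ≤ u) : Real.exp (-u) ≤ 1 - u + u ^ 2 / 2 := by
  have h := Real.quadratic_le_exp_of_nonneg hu
  have hp : 0 < 1 + u + u ^ 2 / 2 := by positivity
  rw [Real.exp_neg]
  calc (Real.exp u)⁻¹ ≤ (1 + u + u ^ 2 / 2)⁻¹ := by gcongr
    _ ≤ _ := by
      rw [inv_le_iff_one_le_mul₀ hp]
      nlinarith [sq_nonneg (u ^ 2)]

/-- The lower tail of a sum of independent nonnegative variables with bounded second moment. -/
theorem lower_tail_le {X : Type*} [Fintype X] {p : X → ℝ} (hp : p ∈ stdSimplex ℝ X) (f : X → ℝ)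
    (hf : ∀ a, 0 < p a → 0 ≤ f a) {V τ : ℝ} (hV : 0 < V) (hfV : ∑ a, p a * f a ^ 2 ≤ V)
    (hτ : 0 ≤ τ) (n : ℕ) :
    ∑ x : Fin n → X, seqLaw p x *
      (if ∑ i, f (x i) ≤ n * (∑ a, p a * f a - τ) then 1 else 0) ≤
      Real.exp (-(n * (τ ^ 2 / (2 * V)))) := by
  set m := ∑ a, p a * f a with hm
  -- The minimizer of the exponent t² V / 2 − t τ.
  set t := τ / V with ht
  have ht0 : 0 ≤ t := by positivity
  have hone : ∑ a, p a * Real.exp (-(t * f a)) ≤ Real.exp (-(t * m) + t ^ 2 * V / 2) := by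
    calc ∑ a, p a * Real.exp (-(t * f a))
        ≤ ∑ a, p a * (1 - t * f a + (t * f a) ^ 2 / 2) := by
          refine Finset.sum_le_sum fun a _ => ?_
          rcases (hp.1 a).eq_or_lt with h | h
          · simp [← h]
          · exact mul_le_mul_of_nonneg_left
              (exp_neg_le_quadratic (mul_nonneg ht0 (hf a h))) h.le
      _ = ∑ a, p a - t * m + t ^ 2 / 2 * ∑ a, p a * f a ^ 2 := by
          rw [hm, Finset.mul_sum, Finset.mul_sum, ← Finset.sum_sub_distrib,
            ← Finset.sum_add_distrib]
          exact Finset.sum_congr rfl fun a _ => by ring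
      _ ≤ 1 - t * m + t ^ 2 / 2 * V := by rw [hp.2]; gcongr
      _ = (-(t * m) + t ^ 2 * V / 2) + 1 := by ring
      _ ≤ _ := Real.add_one_le_exp _
  calc _ ≤ ∑ x : Fin n → X, Real.exp (n * (t * (m - τ))) *
            ∏ i, (p (x i) * Real.exp (-(t * f (x i)))) := by
        refine Finset.sum_le_sum fun x _ => ?_
        rw [Finset.prod_mul_distrib, ← Real.exp_sum, mul_left_comm, ← Real.exp_add,
          Finset.sum_neg_distrib, ← Finset.mul_sum, seqLaw]
        refine mul_le_mul_of_nonneg_left ?_ (Finset.prod_nonneg fun i _ => hp.1 _)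
        split_ifs with h
        · rw [← Real.exp_zero]
          refine Real.exp_le_exp.2 ?_
          nlinarith [mul_le_mul_of_nonneg_left h ht0]
        · positivity
    _ = Real.exp (n * (t * (m - τ))) * ∏ _i : Fin n, ∑ a, p a * Real.exp (-(t * f a)) := by
        rw [← Finset.mul_sum, sum_prod_apply fun _ a => p a * Real.exp (-(t * f a))]
    _ ≤ Real.exp (n * (t * (m - τ))) * ∏ _i : Fin n, Real.exp (-(t * m) + t ^ 2 * V / 2) := by
        gcongr with i _
        intro i _
        exact Finset.sum_nonneg fun a _ => mul_nonneg (hp.1 a) (Real.exp_pos _).le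
    _ = _ := by
        rw [Finset.prod_const, Finset.card_univ, Fintype.card_fin, ← Real.exp_nat_mul,
          ← Real.exp_add]
        congr 1
        rw [ht]; field_simp; ring

/-! ### Second moment of the self-information -/

/-- The optimal constant is 1/e; 2/5 is a rational value just above it. -/
theorem log_le_two_fifths_mul {z : ℝ} (hz : 0 < z) : Real.log z ≤ 2 / 5 * z := by
  have h1 : Real.log (2 / 5 * z) ≤ 2 / 5 * z - 1 := Real.log_le_sub_one_of_pos (by positivity)
  rw [Real.log_mul (by norm_num) hz.ne'] at h1
  have h2 : Real.log (5 / 2) ≤ 1 := by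
    rw [Real.log_le_iff_le_exp (by norm_num)]
    linarith [Real.exp_one_gt_d9]
  have h3 : Real.log (2 / 5) = -Real.log (5 / 2) := by rw [← Real.log_inv]; norm_num
  linarith

/-- The second moment of the self-information is at most `4 (log |X|)²`. -/
theorem sum_mul_logb_sq_le {X : Type*} [Fintype X] {p : X → ℝ} (hp : p ∈ stdSimplex ℝ X)
    (hX : 2 ≤ Fintype.card X) :
    ∑ a, p a * Real.logb 2 (1 / p a) ^ 2 ≤ 4 * Real.logb 2 (Fintype.card X) ^ 2 := by
  set k : ℝ := (Fintype.card X : ℝ) with hk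
  have hk2 : (2 : ℝ) ≤ k := by rw [hk]; exact_mod_cast hX
  set L := Real.log k with hL
  have hLlow : 0.69 ≤ L := le_trans (by linarith [Real.log_two_gt_d9])
    (Real.log_le_log (by norm_num) hk2)
  -- Only letters with p a < 1/k can exceed L². There log(1/p a) = L + log w with w = 1/(k p a), and
  -- log w ≤ 0.4 w, (log w)² ≤ 0.64 w bound the excess by a multiple of w, with p a · w = 1/k.
  have hpt : ∀ a, p a * Real.log (1 / p a) ^ 2 ≤ p a * L ^ 2 + (0.8 * L + 0.64) / k := by
    intro a
    rcases (hp.1 a).eq_or_lt with h | h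
    · rw [← h]; simp; positivity
    have ha1 : p a ≤ 1 := by
      rw [← hp.2]; exact Finset.single_le_sum (fun b _ => hp.1 b) (Finset.mem_univ a)
    set u := 1 / p a with hu
    have hu1 : 1 ≤ u := by rw [hu, le_div_iff₀ h]; linarith
    have hu0 : 0 < u := by linarith
    have hlu : 0 ≤ Real.log u := Real.log_nonneg hu1
    rcases le_total u k with huk | huk
    · have : Real.log u ≤ L := Real.log_le_log hu0 huk
      have : p a * Real.log u ^ 2 ≤ p a * L ^ 2 := by gcongr
      have : 0 ≤ (0.8 * L + 0.64) / k := by positivity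
      linarith
    · set w := u / k with hw
      have hw0 : 0 < w := by positivity
      have hw1 : 1 ≤ w := by rw [hw, le_div_iff₀ (by linarith)]; linarith
      have hsplit : Real.log u = L + Real.log w := by
        rw [hw, Real.log_div hu0.ne' (by positivity)]; ring
      have h1 := log_le_two_fifths_mul hw0
      have h0 : 0 ≤ Real.log w := Real.log_nonneg hw1
      have h2 : Real.log w ^ 2 ≤ 0.64 * w := by
        have hsq := log_le_two_fifths_mul (Real.sqrt_pos.2 hw0)
        rw [Real.log_sqrt hw0.le] at hsq
        have : Real.log w ≤ 0.8 * √w := by linarith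
        calc Real.log w ^ 2 ≤ (0.8 * √w) ^ 2 := by gcongr
          _ = 0.64 * w := by rw [mul_pow, Real.sq_sqrt hw0.le]; norm_num
      have h3 : Real.log u ^ 2 ≤ L ^ 2 + (0.8 * L + 0.64) * w := by
        rw [hsplit]; nlinarith
      calc p a * Real.log u ^ 2 ≤ p a * (L ^ 2 + (0.8 * L + 0.64) * w) := by gcongr
        _ = _ := by
          rw [hw, hu]; field_simp
  have hsum : ∑ a, p a * Real.log (1 / p a) ^ 2 ≤ L ^ 2 + (0.8 * L + 0.64) := by
    calc _ ≤ ∑ a, (p a * L ^ 2 + (0.8 * L + 0.64) / k) := Finset.sum_le_sum fun a _ => hpt a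
      _ = _ := by
        rw [Finset.sum_add_distrib, ← Finset.sum_mul, hp.2, Finset.sum_const, Finset.card_univ,
          nsmul_eq_mul, ← hk]
        field_simp
  have hl2 : 0 < Real.log 2 := Real.log_pos (by norm_num)
  -- Here 0.8 L + 0.64 ≤ 3 L² because L ≥ 0.69; this is where |X| ≥ 2 enters.
  have hfin : ∑ a, p a * Real.log (1 / p a) ^ 2 ≤ 4 * L ^ 2 := by nlinarith
  simp only [Real.logb, div_pow, ← mul_div_assoc]
  rw [← Finset.sum_div]
  gcongr

/-! ### Single-letter information quantities -/

theorem sum_posterior_le_one {X Y : Type*} [Fintype X] (p : X → ℝ) (W : X → Y → ℝ) (b : Y) :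
    ∑ a, posterior p W a b ≤ 1 := by
  simp only [posterior]
  rw [← Finset.sum_div]
  exact div_self_le_one (outputLaw p W b)

theorem seqChannel_mem {X Y : Type*} [Fintype Y] {W : X → Y → ℝ} {n : ℕ}
    (hW : ∀ x, W x ∈ stdSimplex ℝ Y) (x : Fin n → X) :
    seqChannel W x ∈ stdSimplex ℝ (Fin n → Y) := by
  refine ⟨fun y => Finset.prod_nonneg fun i _ => (hW (x i)).1 _, ?_⟩
  simp only [seqChannel]
  rw [sum_prod_apply fun i b => W (x i) b]
  simp [(hW _).2]

section Information

variable {X Y : Type*} [Fintype X] [Fintype Y]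

/-- The conditional mean of `log (1 / μ_{X|Y}(a|Y))` given the input `a`. -/
noncomputable def meanSurprisal (p : X → ℝ) (W : X → Y → ℝ) (a : X) : ℝ :=
  ∑ b, W a b * Real.logb 2 (1 / posterior p W a b)

/-- The information `D(W(·|a) ‖ μ_Y)` of the input `a`. -/
noncomputable def inputInfo (p : X → ℝ) (W : X → Y → ℝ) (a : X) : ℝ :=
  Real.logb 2 (1 / p a) - meanSurprisal p W a

variable {p : X → ℝ} {W : X → Y → ℝ}

theorem outputLaw_nonneg (hp : p ∈ stdSimplex ℝ X) (hW : ∀ x, W x ∈ stdSimplex ℝ Y) (b : Y) :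
    0 ≤ outputLaw p W b :=
  Finset.sum_nonneg fun a _ => mul_nonneg (hp.1 a) ((hW a).1 b)

theorem mul_le_outputLaw (hp : p ∈ stdSimplex ℝ X) (hW : ∀ x, W x ∈ stdSimplex ℝ Y) (a : X)
    (b : Y) : p a * W a b ≤ outputLaw p W b :=
  Finset.single_le_sum (f := fun a => p a * W a b)
    (fun a _ => mul_nonneg (hp.1 a) ((hW a).1 b)) (Finset.mem_univ a)

theorem sum_outputLaw (hp : p ∈ stdSimplex ℝ X) (hW : ∀ x, W x ∈ stdSimplex ℝ Y) :
    ∑ b, outputLaw p W b = 1 := by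
  simp only [outputLaw]
  rw [Finset.sum_comm]
  simp only [← Finset.mul_sum, (hW _).2, mul_one, hp.2]

theorem posterior_nonneg (hp : p ∈ stdSimplex ℝ X) (hW : ∀ x, W x ∈ stdSimplex ℝ Y) (a : X)
    (b : Y) : 0 ≤ posterior p W a b :=
  div_nonneg (mul_nonneg (hp.1 a) ((hW a).1 b)) (outputLaw_nonneg hp hW b)

theorem posterior_le_one (hp : p ∈ stdSimplex ℝ X) (hW : ∀ x, W x ∈ stdSimplex ℝ Y) (a : X)
    (b : Y) : posterior p W a b ≤ 1 :=
  div_le_one_of_le₀ (mul_le_outputLaw hp hW a b) (outputLaw_nonneg hp hW b)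

theorem posterior_pos (hp : p ∈ stdSimplex ℝ X) (hW : ∀ x, W x ∈ stdSimplex ℝ Y) {a : X}
    {b : Y} (ha : 0 < p a) (hab : 0 < W a b) : 0 < posterior p W a b :=
  div_pos (mul_pos ha hab) ((mul_pos ha hab).trans_le (mul_le_outputLaw hp hW a b))

theorem posterior_mul_outputLaw (hp : p ∈ stdSimplex ℝ X) (hW : ∀ x, W x ∈ stdSimplex ℝ Y) (a : X)
    (b : Y) : posterior p W a b * outputLaw p W b = p a * W a b := by
  rcases (outputLaw_nonneg hp hW b).eq_or_lt with h | h
  · have h1 := mul_le_outputLaw hp hW a b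
    have h2 := mul_nonneg (hp.1 a) ((hW a).1 b)
    rw [← h, mul_zero]
    linarith
  · rw [posterior, div_mul_cancel₀ _ h.ne']

theorem sum_mul_meanSurprisal (hp : p ∈ stdSimplex ℝ X) (hW : ∀ x, W x ∈ stdSimplex ℝ Y) :
    ∑ a, p a * meanSurprisal p W a = condEntropy p W := by
  simp only [meanSurprisal, condEntropy, Finset.mul_sum, posterior_mul_outputLaw hp hW, mul_assoc]

theorem sum_mul_inputInfo (hp : p ∈ stdSimplex ℝ X) (hW : ∀ x, W x ∈ stdSimplex ℝ Y) :
    ∑ a, p a * inputInfo p W a = mutualInfo p W := by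
  simp only [inputInfo, mul_sub, Finset.sum_sub_distrib, sum_mul_meanSurprisal hp hW, mutualInfo,
    entropy]

theorem meanSurprisal_nonneg (hp : p ∈ stdSimplex ℝ X) (hW : ∀ x, W x ∈ stdSimplex ℝ Y) (a : X) :
    0 ≤ meanSurprisal p W a := by
  refine Finset.sum_nonneg fun b _ => mul_nonneg ((hW a).1 b) ?_
  rw [one_div, Real.logb_inv, neg_nonneg]
  exact Real.logb_nonpos (by norm_num) (posterior_nonneg hp hW a b) (posterior_le_one hp hW a b)

theorem inputInfo_le (hp : p ∈ stdSimplex ℝ X) (hW : ∀ x, W x ∈ stdSimplex ℝ Y) (a : X) :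
    inputInfo p W a ≤ Real.logb 2 (1 / p a) :=
  sub_le_self _ (meanSurprisal_nonneg hp hW a)

/-- Gibbs' inequality, from log z ≤ z − 1. Positivity of p a is what makes the quantity a genuine
divergence: it rules out the default values of 1/0 and log 0. -/
theorem inputInfo_nonneg (hp : p ∈ stdSimplex ℝ X) (hW : ∀ x, W x ∈ stdSimplex ℝ Y) {a : X}
    (ha : 0 < p a) : 0 ≤ inputInfo p W a := by
  have hl2 : 0 < Real.log 2 := Real.log_pos (by norm_num)
  have hterm : ∀ b, W a b * Real.logb 2 (1 / posterior p W a b) ≤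
      W a b * Real.logb 2 (1 / p a) + (outputLaw p W b - W a b) / Real.log 2 := by
    intro b
    rcases ((hW a).1 b).eq_or_lt with h | h
    · rw [← h]
      simpa using div_nonneg (outputLaw_nonneg hp hW b) hl2.le
    · have hq : 0 < outputLaw p W b := (mul_pos ha h).trans_le (mul_le_outputLaw hp hW a b)
      have h1 : 1 / posterior p W a b = 1 / p a * (outputLaw p W b / W a b) := by
        rw [posterior]; field_simp
      rw [h1, Real.logb_mul (by positivity) (by positivity), mul_add]
      refine add_le_add le_rfl ?_
      rw [Real.logb, ← mul_div_assoc]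
      gcongr
      calc W a b * Real.log (outputLaw p W b / W a b)
          ≤ W a b * (outputLaw p W b / W a b - 1) := by
            gcongr
            exact Real.log_le_sub_one_of_pos (by positivity)
        _ = _ := by field_simp
  have : meanSurprisal p W a ≤ Real.logb 2 (1 / p a) := by
    calc meanSurprisal p W a ≤ ∑ b, (W a b * Real.logb 2 (1 / p a) +
          (outputLaw p W b - W a b) / Real.log 2) := Finset.sum_le_sum fun b _ => hterm b
      _ = _ := by
        rw [Finset.sum_add_distrib, ← Finset.sum_mul, ← Finset.sum_div, Finset.sum_sub_distrib,
          sum_outputLaw hp hW, (hW a).2]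
        simp
  exact sub_nonneg.2 this

/-- On the support of p the information lies between 0 and the self-information, so the latter's
second moment dominates. -/
theorem sum_mul_inputInfo_sq_le (hp : p ∈ stdSimplex ℝ X) (hW : ∀ x, W x ∈ stdSimplex ℝ Y)
    (hX : 2 ≤ Fintype.card X) :
    ∑ a, p a * inputInfo p W a ^ 2 ≤ 4 * Real.logb 2 (Fintype.card X) ^ 2 := by
  refine le_trans (Finset.sum_le_sum fun a _ => ?_) (sum_mul_logb_sq_le hp hX)
  rcases (hp.1 a).eq_or_lt with h | h
  · simp [← h]
  · have h0 := inputInfo_nonneg hp hW h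
    have h1 := inputInfo_le hp hW a
    gcongr

/-! ### Counting and concentration for sequences -/

variable {n : ℕ}

theorem seqLaw_nonneg (hp : p ∈ stdSimplex ℝ X) (x : Fin n → X) : 0 ≤ seqLaw p x :=
  Finset.prod_nonneg fun i _ => hp.1 (x i)

theorem pos_of_seqLaw_pos (hp : p ∈ stdSimplex ℝ X) {x : Fin n → X} (hx : 0 < seqLaw p x)
    (i : Fin n) : 0 < p (x i) :=
  (hp.1 _).lt_of_ne' fun h => hx.ne' (Finset.prod_eq_zero (Finset.mem_univ i) h)

theorem sum_seqLaw (hp : p ∈ stdSimplex ℝ X) : ∑ x : Fin n → X, seqLaw p x = 1 := by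
  simp only [seqLaw]
  rw [sum_prod_apply fun _ a => p a]
  simp [hp.2]

theorem prod_eq_rpow_neg_sum (h : Fin n → ℝ) (hpos : ∀ i, 0 < h i) :
    ∏ i, h i = (2 : ℝ) ^ (-∑ i, Real.logb 2 (1 / h i)) := by
  rw [← Finset.sum_neg_distrib, Real.rpow_sum_of_pos (by norm_num)]
  refine Finset.prod_congr rfl fun i _ => ?_
  rw [one_div, Real.logb_inv, neg_neg, Real.rpow_logb (by norm_num) (by norm_num) (hpos i)]

theorem seqLaw_eq_rpow (hp : p ∈ stdSimplex ℝ X) {x : Fin n → X} (hx : 0 < seqLaw p x) :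
    seqLaw p x = (2 : ℝ) ^ (-∑ i, Real.logb 2 (1 / p (x i))) :=
  prod_eq_rpow_neg_sum _ (pos_of_seqLaw_pos hp hx)

/-- There are at least `2^{n (H(X) - s)} / 2` sequences of probability at least
`2^{-n (H(X) + s)}`. -/
theorem eventually_le_card_likely (hp : p ∈ stdSimplex ℝ X) {s : ℝ} (hs : 0 < s) :
    ∀ᶠ n : ℕ in atTop, (2 : ℝ) ^ (n * (entropy p - s)) / 2 ≤
      ((Finset.univ.filter fun x : Fin n → X =>
        (2 : ℝ) ^ (-(n * (entropy p + s))) ≤ seqLaw p x).card : ℝ) := by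
  classical
  set g : X → ℝ := fun a => Real.logb 2 (1 / p a) - entropy p with hg
  have hg0 : ∑ a, p a * g a = 0 := by
    simp only [hg, mul_sub, Finset.sum_sub_distrib, ← Finset.sum_mul, hp.2, one_mul]
    exact sub_self _
  set M : ℝ := 1 + ∑ a, |g a| with hM
  have hM0 : 0 < M := by positivity
  have hgM : ∀ a, |g a| ≤ M := fun a => by
    have := Finset.single_le_sum (f := fun a => |g a|) (fun b _ => abs_nonneg _)
      (Finset.mem_univ a)
    linarith
  obtain ⟨r, hr0, hr1, hr⟩ := exists_chernoff_rate M s hM0 hs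
  have hlim := tendsto_pow_atTop_nhds_zero_of_lt_one hr0.le hr1
  filter_upwards [hlim.eventually_lt_const (show (0 : ℝ) < 1 / 4 by norm_num)] with n hn
  have h1 := hr n (fun _ => p) (fun _ => g) (fun _ => hp) (fun _ => hgM) (fun _ => hg0)
  have h2 := hr n (fun _ => p) (fun _ a => -g a) (fun _ => hp) (fun _ a => by simpa using hgM a)
    (fun _ => by simpa using hg0)
  set T := Finset.univ.filter fun x : Fin n → X =>
    (2 : ℝ) ^ (-(n * (entropy p + s))) ≤ seqLaw p x with hT
  -- The two deviation events carry total mass below 1/2. Any other x of positive probability is in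
  -- T and has probability at most 2^{-n(H−s)}, so T needs enough points to carry the remaining
  -- mass.
  have hpt : ∀ x : Fin n → X, seqLaw p x ≤
      (if x ∈ T then (2 : ℝ) ^ (-(n * (entropy p - s))) else 0) +
      ((∏ i, p (x i)) * (if n * s ≤ ∑ i, g (x i) then 1 else 0) +
        (∏ i, p (x i)) * (if n * s ≤ ∑ i, -g (x i) then 1 else 0)) := by
    intro x
    rcases (seqLaw_nonneg hp x).eq_or_lt with h | h
    · rw [← h]
      have : ∏ i, p (x i) = 0 := h.symm
      rw [this]
      simp only [zero_mul, add_zero]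
      split_ifs <;> positivity
    have hpr : ∏ i, p (x i) = seqLaw p x := rfl
    have hsum : ∑ i, g (x i) = ∑ i, Real.logb 2 (1 / p (x i)) - n * entropy p := by
      simp [hg, Finset.sum_sub_distrib]
    have hite0 : (0 : ℝ) ≤ if x ∈ T then (2 : ℝ) ^ (-(n * (entropy p - s))) else 0 := by
      split_ifs <;> positivity
    rw [hpr]
    by_cases hA : n * s ≤ ∑ i, g (x i)
    · rw [if_pos hA]
      have : 0 ≤ seqLaw p x * (if n * s ≤ ∑ i, -g (x i) then (1 : ℝ) else 0) := by
        split_ifs <;> simp [h.le]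
      linarith
    by_cases hB : n * s ≤ ∑ i, -g (x i)
    · rw [if_pos hB, if_neg hA]
      linarith
    rw [if_neg hA, if_neg hB]
    rw [Finset.sum_neg_distrib] at hB
    push Not at hA hB
    have hxT : x ∈ T := by
      rw [hT, Finset.mem_filter, seqLaw_eq_rpow hp h]
      refine ⟨Finset.mem_univ _, Real.rpow_le_rpow_of_exponent_le (by norm_num) ?_⟩
      linarith
    rw [if_pos hxT, mul_zero, add_zero, add_zero, seqLaw_eq_rpow hp h]
    exact Real.rpow_le_rpow_of_exponent_le (by norm_num) (by linarith)
  have htot := Finset.sum_le_sum fun x (_ : x ∈ Finset.univ) => hpt x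
  rw [sum_seqLaw hp, Finset.sum_add_distrib, Finset.sum_add_distrib, Finset.sum_ite_mem,
    Finset.univ_inter, Finset.sum_const, nsmul_eq_mul] at htot
  have hhalf : 1 / 2 ≤ (T.card : ℝ) * (2 : ℝ) ^ (-(n * (entropy p - s))) := by linarith
  rw [Real.rpow_neg (by norm_num)] at hhalf
  have hpos : (0 : ℝ) < (2 : ℝ) ^ (n * (entropy p - s)) := by positivity
  rw [← div_eq_mul_inv, le_div_iff₀ hpos] at hhalf
  linarith

/-- Few likely sequences carry little information. -/
theorem card_uninformative_le (hp : p ∈ stdSimplex ℝ X) (hW : ∀ x, W x ∈ stdSimplex ℝ Y)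
    (hX : 2 ≤ Fintype.card X) {τ : ℝ} (hτ : 0 ≤ τ) (h : ℝ) (n : ℕ) :
    ((Finset.univ.filter fun x : Fin n → X => (2 : ℝ) ^ (-(n * h)) ≤ seqLaw p x ∧
      ∑ i, inputInfo p W (x i) ≤ n * (mutualInfo p W - τ)).card : ℝ) ≤
      2 ^ (n * h) * Real.exp (-(n * (τ ^ 2 / (8 * Real.logb 2 (Fintype.card X) ^ 2)))) := by
  have hl : 0 < Real.logb 2 (Fintype.card X) :=
    Real.logb_pos (by norm_num) (by exact_mod_cast hX)
  have key := lower_tail_le hp (inputInfo p W) (fun a ha => inputInfo_nonneg hp hW ha)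
    (V := 4 * Real.logb 2 (Fintype.card X) ^ 2) (by positivity)
    (sum_mul_inputInfo_sq_le hp hW hX) hτ n
  rw [sum_mul_inputInfo hp hW, ← mul_assoc, show (2 : ℝ) * 4 = 8 by norm_num] at key
  refine le_trans ?_ (mul_le_mul_of_nonneg_left key (by positivity))
  rw [Finset.card_filter, Nat.cast_sum, Finset.mul_sum]
  -- Each counted x satisfies 1 ≤ 2^{nh} μ_X(x), which turns the tail probability into a count.
  refine Finset.sum_le_sum fun x _ => ?_
  have h0 := seqLaw_nonneg hp x
  by_cases hx : (2 : ℝ) ^ (-(n * h)) ≤ seqLaw p x ∧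
      ∑ i, inputInfo p W (x i) ≤ n * (mutualInfo p W - τ)
  · rw [if_pos hx, if_pos hx.2, mul_one]
    calc ((1 : ℕ) : ℝ) = 2 ^ (n * h) * 2 ^ (-(n * h)) := by
          rw [← Real.rpow_add (by norm_num)]; simp
      _ ≤ _ := by gcongr; exact hx.1
  · rw [if_neg hx]
    split_ifs <;> simp
    positivity

/-- The output of the channel is unlikely to have a posterior much smaller than its conditional
mean on the logarithmic scale. -/
theorem exists_posterior_tail_rate (hp : p ∈ stdSimplex ℝ X) (hW : ∀ x, W x ∈ stdSimplex ℝ Y)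
    {s : ℝ} (hs : 0 < s) :
    ∃ r : ℝ, 0 < r ∧ r < 1 ∧ ∀ (n : ℕ) (x : Fin n → X), 0 < seqLaw p x →
      ∀ h : ℝ, ∑ i, meanSurprisal p W (x i) + n * s ≤ h →
      ∑ y, seqChannel W x y * (if seqPosterior p W x y < (2 : ℝ) ^ (-h) then 1 else 0) ≤
        r ^ n := by
  set g : X → Y → ℝ := fun a b =>
    Real.logb 2 (1 / posterior p W a b) - meanSurprisal p W a with hg
  have hg0 : ∀ a, ∑ b, W a b * g a b = 0 := fun a => by
    simp only [hg, mul_sub, Finset.sum_sub_distrib, ← Finset.sum_mul, (hW a).2, one_mul]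
    exact sub_self _
  set M : ℝ := 1 + ∑ a, ∑ b, |g a b| with hM
  have hM0 : 0 < M := by positivity
  have hgM : ∀ a b, |g a b| ≤ M := fun a b => by
    have h1 := Finset.single_le_sum (f := fun a => ∑ b, |g a b|)
      (fun b _ => Finset.sum_nonneg fun _ _ => abs_nonneg _) (Finset.mem_univ a)
    have h2 := Finset.single_le_sum (f := fun b => |g a b|) (fun b _ => abs_nonneg _)
      (Finset.mem_univ b)
    linarith
  obtain ⟨r, hr0, hr1, hr⟩ := exists_chernoff_rate M s hM0 hs
  refine ⟨r, hr0, hr1, fun n x hx h hh => ?_⟩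
  refine le_trans (Finset.sum_le_sum fun y _ => ?_)
    (hr n (fun i => W (x i)) (fun i => g (x i)) (fun i => hW _) (fun i => hgM _)
      (fun i => hg0 _))
  change seqChannel W x y * _ ≤ seqChannel W x y * _
  rcases ((seqChannel_mem hW x).1 y).eq_or_lt with h0 | h0
  · rw [← h0]; simp
  refine mul_le_mul_of_nonneg_left ?_ h0.le
  by_cases hy : seqPosterior p W x y < (2 : ℝ) ^ (-h)
  swap
  · rw [if_neg hy]; split_ifs <;> norm_num
  have hWpos : ∀ i, 0 < W (x i) (y i) := fun i =>
    ((hW _).1 _).lt_of_ne' fun hz => h0.ne' (Finset.prod_eq_zero (Finset.mem_univ i) hz)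
  have hpost : seqPosterior p W x y =
      (2 : ℝ) ^ (-∑ i, Real.logb 2 (1 / posterior p W (x i) (y i))) :=
    prod_eq_rpow_neg_sum _ fun i => posterior_pos hp hW (pos_of_seqLaw_pos hp hx i) (hWpos i)
  rw [hpost, Real.rpow_lt_rpow_left_iff (by norm_num)] at hy
  rw [if_pos (by rw [hpost, Real.rpow_lt_rpow_left_iff (by norm_num)]; exact hy), if_pos]
  simp only [hg, Finset.sum_sub_distrib]
  linarith

/-- For fixed y the posterior has total mass at most 1; the mass is 0, not 1, when some output
letter has probability 0. -/
theorem card_likely_posterior_le (hp : p ∈ stdSimplex ℝ X) (hW : ∀ x, W x ∈ stdSimplex ℝ Y)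
    (y : Fin n → Y) (h : ℝ) :
    ((Finset.univ.filter fun x : Fin n → X =>
      (2 : ℝ) ^ (-h) ≤ seqPosterior p W x y).card : ℝ) ≤ 2 ^ h := by
  have hpos : (0 : ℝ) < 2 ^ h := by positivity
  have h1 : ∑ x : Fin n → X, seqPosterior p W x y ≤ 1 := by
    simp only [seqPosterior]
    rw [sum_prod_apply fun i a => posterior p W a (y i)]
    exact Finset.prod_le_one
      (fun i _ => Finset.sum_nonneg fun a _ => posterior_nonneg hp hW a _)
      (fun i _ => sum_posterior_le_one p W _)
  have h2 : ((Finset.univ.filter fun x : Fin n → X =>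
      (2 : ℝ) ^ (-h) ≤ seqPosterior p W x y).card : ℝ) * 2 ^ (-h) ≤
      ∑ x : Fin n → X, seqPosterior p W x y := by
    rw [← nsmul_eq_mul]
    refine le_trans (Finset.card_nsmul_le_sum _ _ _ fun x hx => (Finset.mem_filter.1 hx).2) ?_
    exact Finset.sum_le_sum_of_subset_of_nonneg (Finset.filter_subset _ _) fun x _ _ =>
      Finset.prod_nonneg fun i _ => posterior_nonneg hp hW _ _
  have h3 := h2.trans h1
  rw [show (2 : ℝ) ^ (-h) = 1 / 2 ^ h by rw [Real.rpow_neg (by norm_num), one_div]] at h3 ⊢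
  rwa [mul_one_div, div_le_one hpos] at h3

end Information

/-! ### From the average to a code, and asymptotics -/

/-- A code with small error exists if the average of the error bound is small. -/
theorem exists_code_error_lt {D R S Z : Type*} [Fintype D] [DecidableEq D] [Nonempty D]
    [DecidableEq R] [DecidableEq S] [Fintype Z] (EA : Ensemble D R) (EB : Ensemble D S)
    (rank : D ↪ ℕ) (f : D → ℝ) (V q : D → Z → ℝ) (hV : ∀ x, V x ∈ stdSimplex ℝ Z)
    (T U : Finset D) (hT : ∀ x ∈ T, ∀ x', rankKey rank f x ≤ rankKey rank f x' → x' ∈ T)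
    {K α β α' β' θ η N ε : ℝ} (hK : 0 < K) (hTK : (T.card : ℝ) = K * (EA.im.card * EB.im.card))
    (hAB : ∑ u ∈ T, ∑ u' ∈ T, (EA.prod EB).collisionProb u u' ≤
      (T.card : ℝ) + T.card * T.card * α / (EA.im ×ˢ EB.im).card + T.card * β)
    (hα' : 0 ≤ α') (hβ' : 0 ≤ β')
    (hA : ∀ x, ∀ G : Finset D, ∑ x' ∈ G, EA.collisionProb x x' ≤
      (({x} ∩ G).card : ℝ) + G.card * α' / EA.im.card + β')
    (hN0 : 0 ≤ N) (hN : ∀ y, ((Finset.univ.filter fun x => θ ≤ q x y).card : ℝ) ≤ N)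
    (hη0 : 0 ≤ η) (hη : ∀ x ∈ T \ U, ∑ y, V x y * (if q x y < θ then 1 else 0) ≤ η)
    (hε : ε ≤ 1)
    (hbound : (α - 1 + (1 + β) / K) + U.card / (EA.im.card * EB.im.card) + η +
      K * (N * α' / EA.im.card + β') < ε) :
    ∃ A ∈ EA.carrier, ∃ B ∈ EB.carrier, ∃ c ∈ Set.range A,
      ∑ m ∈ EB.im, ∑ y, V (argmaxOn rank f (coset A c ∩ coset B m)) y *
        (if B (argmaxOn rank (fun x => q x y) (coset A c)) ≠ m then 1 else 0) <
        EB.im.card * ε := by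
  have hIA : (0 : ℝ) < EA.im.card := by exact_mod_cast EA.im_nonempty.card_pos
  have hIB : (0 : ℝ) < EB.im.card := by exact_mod_cast EB.im_nonempty.card_pos
  have hTpos : (0 : ℝ) < T.card := by rw [hTK]; positivity
  have hTne : T.Nonempty := Finset.card_pos.1 (by exact_mod_cast hTpos)
  set Φ₁ : (D → R) → (D → S) → R → S → ℝ := fun A B c m =>
    if ∃ u ∈ T, A u = c ∧ B u = m then (0 : ℝ) else 1 with hΦ₁
  set Φ₂ : (D → R) → (D → S) → R → S → ℝ := fun A B c m =>
    ∑ x ∈ U, if A x = c ∧ B x = m then (1 : ℝ) else 0 with hΦ₂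
  set Φ₄ : (D → R) → (D → S) → R → S → ℝ := fun A B c m =>
    ∑ x ∈ T \ U, if A x = c ∧ B x = m then
      ∑ y, V x y * ∑ x' ∈ Finset.univ.erase x with θ ≤ q x' y,
        (if A x = A x' then (1 : ℝ) else 0) else 0 with hΦ₄
  have h1 : jointSum EA EB EA.im EB.im Φ₁ ≤ _ := jointSum_missed_le EA EB T hTne hAB
  have h2 : jointSum EA EB EA.im EB.im Φ₂ = U.card := by
    rw [hΦ₂, jointSum_coset EA EB U fun _ _ => 1]
    simp [EA.prob_sum]
  have h4 : jointSum EA EB EA.im EB.im Φ₄ ≤ _ :=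
    jointSum_confusion_le EA EB V q hV (T \ U) hα' hN hA
  have hTU : ((T \ U).card : ℝ) ≤ T.card := by
    exact_mod_cast Finset.card_le_card Finset.sdiff_subset
  have h4' : ((T \ U).card : ℝ) * (N * α' / EA.im.card + β') ≤
      T.card * (N * α' / EA.im.card + β') :=
    mul_le_mul_of_nonneg_right hTU (by positivity)
  have hsum : jointSum EA EB EA.im EB.im
      (fun A B c m => Φ₁ A B c m + Φ₂ A B c m + η + Φ₄ A B c m) <
      EA.im.card * EB.im.card * ε := by
    rw [jointSum_add EA EB _ _ (fun A B c m => Φ₁ A B c m + Φ₂ A B c m + η) Φ₄,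
      jointSum_add EA EB _ _ (fun A B c m => Φ₁ A B c m + Φ₂ A B c m) (fun _ _ _ _ => η),
      jointSum_add, jointSum_const, h2]
    have hI : (0 : ℝ) < EA.im.card * EB.im.card := mul_pos hIA hIB
    refine lt_of_le_of_lt ?_ (mul_lt_mul_of_pos_left hbound hI)
    refine (add_le_add (add_le_add (add_le_add h1 le_rfl) le_rfl) (h4.trans h4')).trans
      (le_of_eq ?_)
    rw [hTK]
    field_simp
  obtain ⟨A, hAm, B, hBm, c, hc, hlt⟩ := exists_of_jointSum_lt EA EB _ _ _ hsum
  refine ⟨A, hAm, B, hBm, c, ?_, ?_⟩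
  -- For c outside the range of A every coset is empty, so the bound is at least 1 for each message,
  -- which ε ≤ 1 excludes.
  · by_contra hcA
    refine absurd hlt (not_lt.2 ?_)
    have hm : ∀ m ∈ EB.im, (1 : ℝ) ≤ Φ₁ A B c m + Φ₂ A B c m + η + Φ₄ A B c m := by
      intro m _
      have e1 : Φ₁ A B c m = 1 := if_neg fun ⟨u, _, hu, _⟩ => hcA ⟨u, hu⟩
      have e2 : Φ₂ A B c m = 0 := Finset.sum_eq_zero fun u _ => if_neg fun h => hcA ⟨u, h.1⟩
      have e4 : Φ₄ A B c m = 0 := Finset.sum_eq_zero fun u _ => if_neg fun h => hcA ⟨u, h.1⟩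
      rw [e1, e2, e4]
      linarith
    calc (EB.im.card : ℝ) * ε ≤ EB.im.card * 1 := by gcongr
      _ = ∑ _m ∈ EB.im, (1 : ℝ) := by simp
      _ ≤ _ := Finset.sum_le_sum hm
  · exact lt_of_le_of_lt (Finset.sum_le_sum fun m _ =>
      message_error_le rank f V q hV T U hT hη0 hη A B c m) hlt

theorem tendsto_two_rpow_neg {c : ℝ} (hc : 0 < c) :
    Tendsto (fun n : ℕ => (2 : ℝ) ^ (-(n * c))) atTop (𝓝 0) := by
  have h1 : (2 : ℝ) ^ (-c) < 1 := Real.rpow_lt_one_of_one_lt_of_neg (by norm_num) (by linarith)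
  refine (tendsto_pow_atTop_nhds_zero_of_lt_one (by positivity) h1).congr fun n => ?_
  rw [← Real.rpow_mul_natCast (by norm_num)]
  congr 1; ring

theorem two_rpow_le_of_le_logb_div {v z : ℝ} {n : ℕ} (hn : 1 ≤ n) (hz : 0 < z)
    (h : v ≤ Real.logb 2 z / n) : (2 : ℝ) ^ (n * v) ≤ z := by
  have hn' : (0 : ℝ) < n := by exact_mod_cast hn
  rw [← Real.le_logb_iff_rpow_le (by norm_num) hz, mul_comm]
  exact (le_div_iff₀ hn').1 h

theorem le_two_rpow_of_logb_div_le {v z : ℝ} {n : ℕ} (hn : 1 ≤ n) (hz : 0 < z)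
    (h : Real.logb 2 z / n ≤ v) : z ≤ (2 : ℝ) ^ (n * v) := by
  have hn' : (0 : ℝ) < n := by exact_mod_cast hn
  rw [← Real.logb_le_iff_le_rpow (by norm_num) hz, mul_comm]
  exact (div_le_iff₀ hn').1 h

/-- The first hash condition says that range and image set have the same exponential growth rate. -/
theorem tendsto_logb_card_image {X : Type*} [DecidableEq X] {R : ℕ → Type*}
    [∀ n, Fintype (R n)] [∀ n, DecidableEq (R n)] [∀ n, Nonempty (R n)]
    {E : ∀ n, Ensemble (Fin n → X) (R n)} {I : ∀ n, Finset (R n)} {α β : ℕ → ℝ}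
    (h : HashConditions E I α β) (hI : ∀ n, (I n).Nonempty) {v : ℝ}
    (hR : Tendsto (fun n : ℕ => Real.logb 2 (Fintype.card (R n)) / (n : ℝ)) atTop (𝓝 v)) :
    Tendsto (fun n : ℕ => Real.logb 2 ((I n).card) / (n : ℝ)) atTop (𝓝 v) := by
  have := hR.sub h.1
  rw [sub_zero] at this
  refine this.congr fun n => ?_
  rw [Real.logb_div (by exact_mod_cast Fintype.card_ne_zero)
    (by exact_mod_cast (hI n).card_pos.ne')]
  ring

/-- The hash inequality with a singleton as first set. Absolute values supply the nonnegative
coefficients needed to enlarge the count of competitors. -/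
theorem HashConditions.sum_collisionProb_le {X : Type*} [DecidableEq X] {R : ℕ → Type*}
    [∀ n, Fintype (R n)] [∀ n, DecidableEq (R n)] {E : ∀ n, Ensemble (Fin n → X) (R n)}
    {I : ∀ n, Finset (R n)} {α β : ℕ → ℝ} (h : HashConditions E I α β) {n : ℕ} (hn : 1 ≤ n)
    (x : Fin n → X) (G : Finset (Fin n → X)) :
    ∑ x' ∈ G, (E n).collisionProb x x' ≤
      (({x} ∩ G).card : ℝ) + G.card * |α n| / (I n).card + |β n| := by
  have := h.2.2.2 n hn {x} G
  rw [Finset.sum_singleton, Finset.card_singleton, Nat.cast_one, one_mul] at this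
  refine this.trans (add_le_add (add_le_add le_rfl ?_) ?_)
  · gcongr
    exact le_abs_self _
  · calc min (1 : ℝ) G.card * β n ≤ min (1 : ℝ) G.card * |β n| := by
          gcongr
          exact le_abs_self _
      _ ≤ 1 * |β n| := by
          gcongr
          exact min_le_left _ _
      _ = |β n| := one_mul _

theorem decodingError_eq {X Y : Type*} [Fintype X] [DecidableEq X] [Nonempty X] [Fintype Y]
    (p : X → ℝ) (W : X → Y → ℝ) {n k l : ℕ} (rank : (Fin n → X) ↪ ℕ)
    (EB : Ensemble (Fin n → X) (Fin l → X))
    (A : (Fin n → X) → (Fin k → X)) (B : (Fin n → X) → (Fin l → X)) (c : Fin k → X) :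
    decodingError p W rank EB A B c = (1 / (EB.im.card : ℝ)) *
      ∑ m ∈ EB.im, ∑ y, seqChannel W (argmaxOn rank (seqLaw p) (coset A c ∩ coset B m)) y *
        (if B (argmaxOn rank (fun x => seqPosterior p W x y) (coset A c)) ≠ m then 1 else 0) := by
  rw [decodingError, Finset.mul_sum, ← Finset.sum_subset (Finset.subset_univ EB.im)]
  · refine Finset.sum_congr rfl fun m hm => ?_
    rw [Finset.mul_sum]
    refine Finset.sum_congr rfl fun y _ => ?_
    rw [messageLaw, if_pos hm, mul_assoc]
    rfl
  · intro m _ hm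
    refine Finset.sum_eq_zero fun y _ => ?_
    rw [messageLaw, if_neg hm, zero_mul, zero_mul]

theorem logb_card_seq (X : Type*) [Fintype X] (l : ℕ) :
    Real.logb 2 (Fintype.card (Fin l → X)) = l * Real.logb 2 (Fintype.card X) := by
  rw [Fintype.card_fun, Fintype.card_fin, Nat.cast_pow, Real.logb_pow]

/-- The most likely sequences: an initial segment of prescribed cardinality of the order used by
the encoder consists of likely sequences. -/
theorem exists_upper_finset_likely {D : Type*} [Fintype D] (rank : D ↪ ℕ) (f : D → ℝ) (θ : ℝ)
    {m : ℕ} (hm : m ≤ (Finset.univ.filter fun x => θ ≤ f x).card) :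
    ∃ T : Finset D, T.card = m ∧
      (∀ x ∈ T, ∀ x', rankKey rank f x ≤ rankKey rank f x' → x' ∈ T) ∧ ∀ x ∈ T, θ ≤ f x := by
  obtain ⟨T, hTm, hT⟩ := exists_upper_finset_card (rankKey_injective rank f) m
    (hm.trans (Finset.card_le_univ _))
  refine ⟨T, hTm, hT, fun x hx => ?_⟩
  by_contra hlt
  refine absurd hm (not_le.2 ?_)
  rw [← hTm]
  refine Finset.card_lt_card ⟨fun z hz => hT x hx z ?_, fun h => hlt ?_⟩
  · rw [rankKey_le_iff]
    exact Or.inl ((not_le.1 hlt).trans_le (Finset.mem_filter.1 hz).2)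
  · exact (Finset.mem_filter.1 (h hx)).2

/-! ### Choice of parameters and conclusion -/

theorem eventually_exists_code {X Y : Type*} [Fintype X] [DecidableEq X] [Nonempty X] [Fintype Y]
    {p : X → ℝ} (hp : p ∈ stdSimplex ℝ X) {W : X → Y → ℝ}
    (hW : ∀ x, W x ∈ stdSimplex ℝ Y) (hX : 2 ≤ Fintype.card X) {εA γ : ℝ} (hγ : 0 < γ)
    (hε : Real.sqrt (6 * γ) * Real.logb 2 (Fintype.card X) < εA) {lA lB : ℕ → ℕ}
    {EA : ∀ n, Ensemble (Fin n → X) (Fin (lA n) → X)}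
    {EB : ∀ n, Ensemble (Fin n → X) (Fin (lB n) → X)} {α β α' β' : ℕ → ℝ}
    (hA : HashConditions EA (fun n => (EA n).im) α' β')
    (hAB : HashConditions (fun n => (EA n).prod (EB n)) (fun n => (EA n).im ×ˢ (EB n).im) α β)
    (hIA : Tendsto (fun n : ℕ => Real.logb 2 ((EA n).im.card) / (n : ℝ)) atTop
      (𝓝 (condEntropy p W + εA)))
    (hI : Tendsto (fun n : ℕ => Real.logb 2 (((EA n).im ×ˢ (EB n).im).card) / (n : ℝ)) atTop
      (𝓝 (entropy p - γ)))
    (rank : ∀ n : ℕ, (Fin n → X) ↪ ℕ) {ε : ℝ} (hε0 : 0 < ε) (hε1 : ε ≤ 1) :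
    ∀ᶠ n : ℕ in atTop, ∃ A ∈ (EA n).carrier, ∃ B ∈ (EB n).carrier, ∃ c ∈ Set.range A,
      decodingError p W (rank n) (EB n) A B c < ε := by
  have hlX : 0 < Real.logb 2 (Fintype.card X) :=
    Real.logb_pos (by norm_num) (by exact_mod_cast hX)
  have hl2 : 0 < Real.log 2 := Real.log_pos (by norm_num)
  set τ := Real.sqrt (6 * γ) * Real.logb 2 (Fintype.card X) with hτ
  have hτ0 : 0 ≤ τ := by positivity
  have hτsq : τ ^ 2 / (8 * Real.logb 2 (Fintype.card X) ^ 2) = 3 / 4 * γ := by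
    rw [hτ, mul_pow, Real.sq_sqrt (by positivity)]
    field_simp
    norm_num
  -- With s ≤ γ/50, γ + 2s ≤ 1.04 γ stays below 3γ/(4 ln 2) ≈ 1.08 γ; the second bound leaves εA − τ
  -- − 3s positive.
  set s := min (γ / 50) ((εA - τ) / 4) with hs
  have hs0 : 0 < s := lt_min (by positivity) (by linarith)
  have hsγ : s ≤ γ / 50 := min_le_left _ _
  have hsτ : s ≤ (εA - τ) / 4 := min_le_right _ _
  -- K must not grow with n: it multiplies β', whose decay may be arbitrarily slow, while the
  -- missing probability tends to 1/K.
  obtain ⟨K, hKε⟩ := exists_nat_gt (10 / ε)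
  have hK0 : (0 : ℝ) < K := lt_trans (by positivity) hKε
  have hKinv : 1 / (K : ℝ) < ε / 10 := by
    rw [div_lt_iff₀ hε0] at hKε
    rw [div_lt_div_iff₀ hK0 (by norm_num)]
    linarith
  obtain ⟨r, hr0, hr1, hr⟩ := exists_posterior_tail_rate hp hW hs0
  have ev1 := hIA.eventually_const_le (show condEntropy p W + εA - s < _ by linarith)
  have ev2 := hI.eventually_const_le (show entropy p - γ - s < _ by linarith)
  have ev3 := hI.eventually_le_const (show entropy p - γ < entropy p - γ + s by linarith)
  have ev4 := eventually_le_card_likely hp hs0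
  have ev5 : ∀ᶠ n : ℕ in atTop, (2 : ℝ) ^ (-(n * (γ - 2 * s))) ≤ 1 / (2 * K) :=
    (tendsto_two_rpow_neg (by linarith)).eventually_le_const (by positivity)
  have ev6 : ∀ᶠ n : ℕ in atTop, α n - 1 + (1 + β n) / K < ε / 5 := by
    have : Tendsto (fun n => α n - 1 + (1 + β n) / K) atTop (𝓝 (1 - 1 + (1 + 0) / K)) :=
      (hAB.2.1.sub_const 1).add ((hAB.2.2.1.const_add 1).div_const _)
    exact this.eventually_lt_const (by rw [sub_self, zero_add, add_zero]; linarith)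
  have hκ : 0 < 3 / 4 * γ / Real.log 2 - (γ + 2 * s) := by
    have : γ + 2 * s < 3 / 4 * γ / Real.log 2 := by
      rw [lt_div_iff₀ hl2]
      nlinarith [Real.log_two_lt_d9]
    linarith
  have ev7 : ∀ᶠ n : ℕ in atTop,
      (2 : ℝ) ^ (-(n * (3 / 4 * γ / Real.log 2 - (γ + 2 * s)))) < ε / 5 :=
    (tendsto_two_rpow_neg hκ).eventually_lt_const (by positivity)
  have ev8 : ∀ᶠ n : ℕ in atTop, r ^ n < ε / 5 :=
    (tendsto_pow_atTop_nhds_zero_of_lt_one hr0.le hr1).eventually_lt_const (by positivity)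
  have ev9 : ∀ᶠ n : ℕ in atTop,
      (K : ℝ) * ((2 : ℝ) ^ (-(n * (εA - τ - 3 * s))) * |α' n| + |β' n|) < ε / 5 := by
    have : Tendsto (fun n : ℕ => (K : ℝ) *
        ((2 : ℝ) ^ (-(n * (εA - τ - 3 * s))) * |α' n| + |β' n|)) atTop
        (𝓝 (K * (0 * |1| + |0|))) :=
      (((tendsto_two_rpow_neg (by linarith)).mul hA.2.1.abs).add hA.2.2.1.abs).const_mul _
    exact this.eventually_lt_const (by simp; positivity)
  filter_upwards [ev1, ev2, ev3, ev4, ev5, ev6, ev7, ev8, ev9, eventually_ge_atTop 1]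
    with n h1 h2 h3 h4 h5 h6 h7 h8 h9 hn
  have hIApos : (0 : ℝ) < (EA n).im.card := by exact_mod_cast (EA n).im_nonempty.card_pos
  have hIBpos : (0 : ℝ) < (EB n).im.card := by exact_mod_cast (EB n).im_nonempty.card_pos
  have hIpos : (0 : ℝ) < ((EA n).im ×ˢ (EB n).im).card := by
    exact_mod_cast ((EA n).im_nonempty.product (EB n).im_nonempty).card_pos
  replace h1 := two_rpow_le_of_le_logb_div hn hIApos h1
  replace h2 := two_rpow_le_of_le_logb_div hn hIpos h2
  replace h3 := le_two_rpow_of_logb_div_le hn hIpos h3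
  have hIcard : (((EA n).im ×ˢ (EB n).im).card : ℝ) = (EA n).im.card * (EB n).im.card := by
    rw [Finset.card_product, Nat.cast_mul]
  have hm : K * ((EA n).im ×ˢ (EB n).im).card ≤ (Finset.univ.filter fun x : Fin n → X =>
      (2 : ℝ) ^ (-(n * (entropy p + s))) ≤ seqLaw p x).card := by
    have : (K : ℝ) * ((EA n).im ×ˢ (EB n).im).card ≤
        (2 : ℝ) ^ (n * (entropy p - s)) / 2 := by
      calc (K : ℝ) * ((EA n).im ×ˢ (EB n).im).card
          ≤ K * 2 ^ (n * (entropy p - γ + s)) := by gcongr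
        _ = K * (2 ^ (n * (entropy p - s)) * (2 : ℝ) ^ (-(n * (γ - 2 * s)))) := by
            rw [← Real.rpow_add (by norm_num)]
            congr 2; ring
        _ ≤ K * (2 ^ (n * (entropy p - s)) * (1 / (2 * K))) := by gcongr
        _ = _ := by field_simp
    exact_mod_cast this.trans h4
  obtain ⟨T, hTcard, hTup, hTlik⟩ := exists_upper_finset_likely (rank n) (seqLaw p) _ hm
  set U := Finset.univ.filter fun x : Fin n → X =>
    (2 : ℝ) ^ (-(n * (entropy p + s))) ≤ seqLaw p x ∧
      ∑ i, inputInfo p W (x i) ≤ n * (mutualInfo p W - τ) with hU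
  have hUcard := card_uninformative_le hp hW hX hτ0 (entropy p + s) n
  rw [← hU, hτsq] at hUcard
  have hUratio : (U.card : ℝ) / ((EA n).im.card * (EB n).im.card) < ε / 5 := by
    refine lt_of_le_of_lt ?_ h7
    rw [← hIcard, div_le_iff₀ hIpos]
    refine hUcard.trans ?_
    calc (2 : ℝ) ^ (n * (entropy p + s)) * Real.exp (-(n * (3 / 4 * γ)))
        = (2 : ℝ) ^ (-(n * (3 / 4 * γ / Real.log 2 - (γ + 2 * s)))) *
            2 ^ (n * (entropy p - γ - s)) := by
          rw [show Real.exp (-(n * (3 / 4 * γ))) =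
            (2 : ℝ) ^ (-(n * (3 / 4 * γ / Real.log 2))) by
              rw [Real.rpow_def_of_pos (by norm_num)]
              congr 1
              field_simp]
          rw [← Real.rpow_add (by norm_num), ← Real.rpow_add (by norm_num)]
          congr 1; ring
      _ ≤ _ := by gcongr
  set h := n * (condEntropy p W + 2 * s + τ) with hh
  -- Self-information at most n(H(X)+s) minus information above n(I(X;Y)−τ) leaves mean surprisal
  -- below n(H(X|Y)+s+τ); the second s in h is the Chernoff margin.
  have hη : ∀ x ∈ T \ U, ∑ y, seqChannel W x y *
      (if seqPosterior p W x y < (2 : ℝ) ^ (-h) then 1 else 0) ≤ r ^ n := by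
    intro x hx
    obtain ⟨hxT, hxU⟩ := Finset.mem_sdiff.1 hx
    have hlik := hTlik x hxT
    have hxpos : 0 < seqLaw p x := lt_of_lt_of_le (by positivity) hlik
    have hinfo : n * (mutualInfo p W - τ) < ∑ i, inputInfo p W (x i) := by
      by_contra hcon
      exact hxU (Finset.mem_filter.2 ⟨Finset.mem_univ _, hlik, not_lt.1 hcon⟩)
    refine hr n x hxpos h ?_
    rw [seqLaw_eq_rpow hp hxpos, Real.rpow_le_rpow_left_iff (by norm_num)] at hlik
    simp only [inputInfo, Finset.sum_sub_distrib, mutualInfo] at hinfo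
    rw [hh]
    linarith
  obtain ⟨A, hAm, B, hBm, c, hc, hlt⟩ := exists_code_error_lt (EA n) (EB n) (rank n) (seqLaw p)
    (seqChannel W) (seqPosterior p W) (seqChannel_mem hW) T U hTup (K := K) (α := α n) (β := β n)
    (α' := |α' n|) (β' := |β' n|) (θ := (2 : ℝ) ^ (-h)) (η := r ^ n) (N := 2 ^ h) (ε := ε) hK0
    (by rw [hTcard, Nat.cast_mul, hIcard])
    (by simpa using hAB.2.2.2 n hn T T) (abs_nonneg _) (abs_nonneg _)
    (hA.sum_collisionProb_le hn) (by positivity) (fun y => card_likely_posterior_le hp hW y h)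
    (by positivity) hη hε1 (by
      have h9' : (K : ℝ) * (2 ^ h * |α' n| / (EA n).im.card + |β' n|) < ε / 5 := by
        refine lt_of_le_of_lt ?_ h9
        gcongr
        rw [div_le_iff₀ hIApos]
        calc (2 : ℝ) ^ h * |α' n|
            = 2 ^ (-(n * (εA - τ - 3 * s))) * |α' n| * 2 ^ (n * (condEntropy p W + εA - s)) := by
              rw [mul_right_comm, ← Real.rpow_add (by norm_num)]
              congr 2; rw [hh]; ring
          _ ≤ _ := by gcongr
      linarith)
  refine ⟨A, hAm, B, hBm, c, hc, ?_⟩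
  rw [decodingError_eq, one_div, inv_mul_lt_iff₀ hIBpos]
  exact hlt

end HashCoding

theorem mainTheorem7 {X Y : Type*} [Fintype X] [DecidableEq X] [Nonempty X] [Fintype Y]
    (μX : X → ℝ) (hμX : μX ∈ stdSimplex ℝ X)
    (W : X → Y → ℝ) (hW : ∀ x, W x ∈ stdSimplex ℝ Y)
    (εA εB : ℝ) (hεA : 0 < εA) (hεAB : εA < εB)
    (hε₁ : εB - εA ≤ Real.sqrt (6 * (εB - εA)) * Real.logb 2 (Fintype.card X))
    (hε₂ : Real.sqrt (6 * (εB - εA)) * Real.logb 2 (Fintype.card X) < εA)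
    (lA lB : ℕ → ℕ)
    (hlA : Tendsto (fun n : ℕ => (lA n : ℝ) * Real.logb 2 (Fintype.card X) / (n : ℝ)) atTop
      (𝓝 (HashCoding.condEntropy μX W + εA)))
    (hlB : Tendsto (fun n : ℕ => (lB n : ℝ) * Real.logb 2 (Fintype.card X) / (n : ℝ)) atTop
      (𝓝 (HashCoding.mutualInfo μX W - εB)))
    (EA : ∀ n, HashCoding.Ensemble (Fin n → X) (Fin (lA n) → X))
    (EB : ∀ n, HashCoding.Ensemble (Fin n → X) (Fin (lB n) → X))
    (hA : HashCoding.HasHashProperty EA)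
    (hAB : HashCoding.HasJointHashProperty EA EB)
    (rank : ∀ n : ℕ, (Fin n → X) ↪ ℕ) :
    ∀ δ : ℝ, 0 < δ → ∀ᶠ n : ℕ in atTop,
      ∃ A ∈ (EA n).carrier, ∃ B ∈ (EB n).carrier, ∃ c ∈ Set.range A,
        HashCoding.rate n (EB n).im ≥ HashCoding.mutualInfo μX W - εB - δ ∧
        HashCoding.decodingError μX W (rank n) (EB n) A B c < δ ∧
        (HashCoding.mutualInfo μX W = HashCoding.capacity W →
          |HashCoding.rate n (EB n).im - HashCoding.capacity W| ≤ εB + δ) := by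
  -- For a one-letter alphabet log|X| = 0, and the first inequality on the parameters would force εB
  -- ≤ εA.
  have hX : 2 ≤ Fintype.card X := by
    by_contra hlt
    have h1 : Fintype.card X = 1 := by
      have := Fintype.card_pos (α := X)
      omega
    rw [h1, Nat.cast_one, Real.logb_one, mul_zero] at hε₁
    linarith
  intro δ hδ
  obtain ⟨α', β', hA⟩ := hA
  obtain ⟨α, β, hAB⟩ := hAB
  have hIA := HashCoding.tendsto_logb_card_image hA (fun n => (EA n).im_nonempty)
    (hlA.congr fun n => by rw [HashCoding.logb_card_seq])
  have hI := HashCoding.tendsto_logb_card_image hAB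
    (fun n => (EA n).im_nonempty.product (EB n).im_nonempty)
    ((hlA.add hlB).congr fun n => by
      rw [Fintype.card_prod, Nat.cast_mul,
        Real.logb_mul (by exact_mod_cast Fintype.card_ne_zero)
          (by exact_mod_cast Fintype.card_ne_zero), HashCoding.logb_card_seq,
        HashCoding.logb_card_seq, add_div])
  -- No hash property is assumed for ℬ alone, so the growth of Im ℬ comes from that of the product
  -- image minus that of Im 𝒜.
  have hrate : Tendsto (fun n => HashCoding.rate n (EB n).im) atTop
      (𝓝 (HashCoding.mutualInfo μX W - εB)) := by
    have := hI.sub hIA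
    rw [add_sub_cancel_left] at this
    refine this.congr fun n => ?_
    rw [Finset.card_product, Nat.cast_mul,
      Real.logb_mul (by exact_mod_cast (EA n).im_nonempty.card_pos.ne')
        (by exact_mod_cast (EB n).im_nonempty.card_pos.ne'), HashCoding.rate]
    ring
  have hval : HashCoding.condEntropy μX W + εA + (HashCoding.mutualInfo μX W - εB) =
      HashCoding.entropy μX - (εB - εA) := by
    rw [HashCoding.mutualInfo]; ring
  rw [hval] at hI
  have hcode := HashCoding.eventually_exists_code hμX hW hX (sub_pos.2 hεAB) hε₂ hA hAB hIA hI
    rank (ε := min δ 1) (lt_min hδ one_pos) (min_le_right _ _)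
  filter_upwards [hcode, hrate.eventually_const_le (show _ - δ < _ from sub_lt_self _ hδ),
    hrate.eventually_le_const (show _ < _ + δ from lt_add_of_pos_right _ hδ)] with n hn h1 h2
  obtain ⟨A, hAm, B, hBm, c, hc, hlt⟩ := hn
  refine ⟨A, hAm, B, hBm, c, hc, h1, hlt.trans_le (min_le_left _ _), fun hcap => ?_⟩
  rw [← hcap, abs_le]
  constructor <;> linarith
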